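/- **Setting.** A PL1P in three views consists of finitely many points and lines in space, an incidence relation $\mathcal I$ between them such that every line is incident to at most one point, and, for each view $v=1,2,3$, the sets $\mathcal P_v$ of points and $\mathcal L_v$ of lines observed in $v$, such that a view which observes two lines incident to a common point also observes that point. A line incident to a point is called a pin of that point; a line incident to no point is free. Let $\Bbbk$ be $\mathbb R$ or $\mathbb C$. Let $\mathcal X$ be the variety of all choices of points $X_i\in\mathbb P^3_\Bbbk$ and lines $L_j\subset\mathbb P^3_\Bbbk$ with $X_i\in L_j$ whenever $(i,j)\in\mathcal I$; let $\mathcal C$ be the variety of triples of calibrated cameras $[R_v\mid t_v]$, $R_v\in\mathrm{SO}(3,\Bbbk)$, $t_v\in\Bbbk^3$, normalized by $R_1=I$, $t_1=0$, $t_{2,1}=1$; let $\mathcal Y$ be the variety of all choices of an image point in $\mathbb P^2_\Bbbk$ for each $v$ and $i\in\mathcal P_v$ and an image line in $\mathbb P^2_\Bbbk$ for each $v$ and $j\in\mathcal L_v$ that satisfy the incidences in $\mathcal I$; and let $\Phi:\mathcal X\times\mathcal C\dashrightarrow\mathcal Y$ be the joint camera map. "Generic" means: on a nonempty Zariski-open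 subset. The PL1P is camera-minimal if $\Phi$ is dominant and, for generic $y\in\mathcal Y$, only finitely many camera triples occur in $\Phi^{-1}(y)$. Keeping only some of the points and lines, and forgetting the others in space and in the views, gives a new PL1P, with joint camera map $\Phi':\mathcal X'\times\mathcal C\dashrightarrow\mathcal Y'$ and forgetting maps $\Pi:\mathcal X\times\mathcal C\to\mathcal X'\times\mathcal C$ and $\pi:\mathcal Y\to\mathcal Y'$. The given PL1P is reducible to the new one if at most one pin of each forgotten point is kept and, for generic $S'\in\mathcal X'\times\mathcal C$ and generic $y\in\pi^{-1}(\Phi'(S'))$, there is $S\in\mathcal X\times\mathcal C$ with $\Phi(S)=y$ and $\Pi(S)=S'$. A PL1P is reduced if it is not reducible to another PL1P (i.e. by forgetting at least one point or line). **Theorem.** Every camera-minimal PL1P in three views is reducible to exactly one reduced PL1P: there is exactly one choice of kept points and lines for which the given PL1P is reducible to the PL1P on the kept features and the latter is reduced. It is obtained by applying the following rules, one after the other and in any order, until none applies any more; every such sequence of rule applications ends with the same kept points and lines. In each rule, "free", "pin", "pins of a point" and "single pin" refer to the points and lines not yet forgotten. One may forget: 1. a pin that is observed in exactly two views, if both of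 these views also observe its point; 2. a free line that is observed in exactly two views; 3. a point with exactly one pin (keeping the pin), if the pin is observed in all three views and the point in exactly one view; 4. a point together with its single pin, if the pin is observed in exactly two views and the point is observed in exactly one view, which is one of these two; 5. a line (free or pin) that is not observed in any view; 6. a free line that is observed in exactly one view; 7. a pin that is observed in exactly one view, if this view also observes its point; 8. a point without pins that is observed in at most one view; 9. a point with exactly one pin (keeping the pin, which becomes a free line), if the point is not observed in any view; 10. a point together with its single pin, if the pin is observed in exactly one view and the point in exactly one view, and these two views are different; 11. a point together with all its pins, if it has at least two pins, the point is not observed in any view, and each of its pins is observed in some view. -/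

import Mathlib

namespace PLP

/-! ### Point-line problems in three views, each line through at most one point -/

/-- A PL1P in three views. `ι` indexes the points and `κ` the lines in space, `inc i j` says that
point `i` lies on line `j`, and `ptObs v`, `lineObs v` are the sets of points and lines observed in
view `v`. (A relation in which every line has at most one point is always realizable by pairwise
distinct points and lines with exactly these incidences, and implies no further incidence, so
realizability and completeness are no extra conditions.) -/
structure PL1P (ι κ : Type*) where
  inc : ι → κ → Prop
  ptObs : Fin 3 → Set ι
  lineObs : Fin 3 → Set κ
  /-- each line is incident to at most one point -/
  inc_unique : ∀ i i' j, inc i j → inc i' j → i = i'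
  /-- a view that observes two meeting lines observes their point of intersection -/
  obs_meet : ∀ v i j j', j ≠ j' → inc i j → inc i j' → j ∈ lineObs v → j' ∈ lineObs v →
    i ∈ ptObs v

/-- The points and the lines that are kept (not forgotten) by a forgetting map. -/
@[ext] structure Kept (ι κ : Type*) where
  pts : Set ι
  lines : Set κ

namespace Kept
variable {ι κ : Type*}

/-- Nothing is forgotten. -/
def all : Kept ι κ := ⟨Set.univ, Set.univ⟩

/-- Forget, in addition, the points in `A` and the lines in `B`. -/
def forget (K : Kept ι κ) (A : Set ι) (B : Set κ) : Kept ι κ := ⟨K.pts \ A, K.lines \ B⟩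

end Kept

/-! ### Geometry -/

/-- Lines of the projective space of `𝕜^n`: two-dimensional linear subspaces of `𝕜^n`. -/
abbrev Line (𝕜 : Type*) [Field 𝕜] (n : ℕ) :=
  {W : Submodule 𝕜 (Fin n → 𝕜) // Module.finrank 𝕜 W = 2}

/-- The rotation part `R` of a camera matrix `[R | t]`. -/
def camRot {𝕜 : Type*} (P : Matrix (Fin 3) (Fin 4) 𝕜) : Matrix (Fin 3) (Fin 3) 𝕜 :=
  P.submatrix id Fin.castSucc

/-- The translation part `t` of a camera matrix `[R | t]`. -/
def camTrans {𝕜 : Type*} (P : Matrix (Fin 3) (Fin 4) 𝕜) : Fin 3 → 𝕜 := fun r => P r (Fin.last 3)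

/-- Configurations of three calibrated cameras `[R_v | t_v]`, in the coordinate system in which the
first camera is `[I | 0]` and the first coordinate of the second translation is `1`. -/
def cameras (𝕜 : Type*) [Field 𝕜] : Set (Fin 3 → Matrix (Fin 3) (Fin 4) 𝕜) :=
  {P | (∀ v, camRot (P v) * (camRot (P v)).transpose = 1 ∧ (camRot (P v)).det = 1) ∧
    camRot (P 0) = 1 ∧ camTrans (P 0) = 0 ∧ camTrans (P 1) 0 = 1}

/-- A configuration of points and lines in `ℙ³` together with three camera matrices. -/
@[ext] structure Scene (𝕜 : Type*) [Field 𝕜] (ι κ : Type*) where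
  pt : ι → Projectivization 𝕜 (Fin 4 → 𝕜)
  line : κ → Line 𝕜 4
  cam : Fin 3 → Matrix (Fin 3) (Fin 4) 𝕜

/-- A joint image: a point of `ℙ²` for every observed point, and a line in `ℙ²` for every observed
line, in each view. -/
@[ext] structure JointImage (𝕜 : Type*) [Field 𝕜] {ι κ : Type*} (Q : PL1P ι κ) where
  pt : ∀ v, Q.ptObs v → Projectivization 𝕜 (Fin 3 → 𝕜)
  line : ∀ v, Q.lineObs v → Line 𝕜 3

/-! ### Genericity

A property of the elements of an irreducible variety `Z` is generic if it holds on a nonempty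
Zariski-open subset of `Z`. Open sets are described in homogeneous coordinates: points are given by
a spanning vector and lines by a pair of spanning vectors. The Zariski topology of a projective
space or of a Grassmannian is the quotient of the Zariski topology on these coordinates, by an open
map, so it suffices to use the loci where one polynomial in the coordinates does not vanish. -/

/-- `p` holds for a generic element of the irreducible variety `Z`, where `C z c` says that
`c` is a vector of homogeneous coordinates of `z`. -/
def GenericOn {𝕜 : Type*} [Field 𝕜] {α σ : Type*} (C : α → (σ → 𝕜) → Prop) (Z : Set α)
    (p : α → Prop) : Prop :=
  ∃ F : MvPolynomial σ 𝕜, (∃ z ∈ Z, ∃ c, C z c ∧ MvPolynomial.eval c F ≠ 0) ∧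
    ∀ z ∈ Z, ∀ c, C z c → MvPolynomial.eval c F ≠ 0 → p z

/-- Homogeneous coordinates of a scene (camera matrices are given by their entries). -/
def Scene.HasCoords {𝕜 : Type*} [Field 𝕜] {ι κ : Type*} (S : Scene 𝕜 ι κ)
    (c : (ι × Fin 4) ⊕ (κ × Fin 2 × Fin 4) ⊕ (Fin 3 × Fin 3 × Fin 4) → 𝕜) : Prop :=
  (∀ i, (S.pt i).submodule = Submodule.span 𝕜 {fun a => c (Sum.inl (i, a))}) ∧
  (∀ j, (S.line j).1 =
    Submodule.span 𝕜 (Set.range fun b : Fin 2 => fun a => c (Sum.inr (Sum.inl (j, b, a))))) ∧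
  (∀ v r a, S.cam v r a = c (Sum.inr (Sum.inr (v, r, a))))

/-- Homogeneous coordinates of a joint image. -/
def JointImage.HasCoords {𝕜 : Type*} [Field 𝕜] {ι κ : Type*} {Q : PL1P ι κ} (y : JointImage 𝕜 Q)
    (c : ((Σ v, Q.ptObs v) × Fin 3) ⊕ ((Σ v, Q.lineObs v) × Fin 2 × Fin 3) → 𝕜) : Prop :=
  (∀ v i, (y.pt v i).submodule = Submodule.span 𝕜 {fun a => c (Sum.inl (⟨v, i⟩, a))}) ∧
  (∀ v j, (y.line v j).1 =
    Submodule.span 𝕜 (Set.range fun b : Fin 2 => fun a => c (Sum.inr (⟨v, j⟩, b, a))))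

namespace PL1P
variable {ι κ : Type*}

/-! ### The joint camera map and camera-minimality -/

/-- The domain `𝒳 × 𝒞` of the joint camera map: point-line arrangements in `ℙ³` that satisfy the
incidences of `Q`, with camera configurations. -/
def sceneVariety (Q : PL1P ι κ) (𝕜 : Type*) [Field 𝕜] : Set (Scene 𝕜 ι κ) :=
  {S | (∀ i j, Q.inc i j → (S.pt i).submodule ≤ (S.line j).1) ∧ S.cam ∈ cameras 𝕜}

/-- The image variety `𝒴`: triples of planar arrangements of the observed points and lines that
satisfy the incidences of `Q`. -/
def imageVariety (Q : PL1P ι κ) (𝕜 : Type*) [Field 𝕜] : Set (JointImage 𝕜 Q) :=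
  {y | ∀ v (i : Q.ptObs v) (j : Q.lineObs v), Q.inc i j →
    (y.pt v i).submodule ≤ (y.line v j).1}

/-- The joint camera map `Φ` is defined at `S` and has value `y`: each observed point or line is
mapped by its camera onto its image. (The images of a point at the centre of a camera that observes
it, and of a line through such a centre, have too small a dimension: there, `Φ` is undefined.) -/
def Projects {𝕜 : Type*} [Field 𝕜] (Q : PL1P ι κ) (S : Scene 𝕜 ι κ) (y : JointImage 𝕜 Q) : Prop :=
  (∀ v (i : Q.ptObs v), (S.pt i).submodule.map (S.cam v).mulVecLin = (y.pt v i).submodule) ∧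
  (∀ v (j : Q.lineObs v), (S.line j).1.map (S.cam v).mulVecLin = (y.line v j).1)

/-- The joint camera map is dominant: its image is Zariski dense in the image variety, that is, it
is not true that a generic joint image has no solution. -/
def IsDominant (Q : PL1P ι κ) (𝕜 : Type*) [Field 𝕜] : Prop :=
  ¬ GenericOn JointImage.HasCoords (Q.imageVariety 𝕜)
    fun y => ¬ ∃ S ∈ Q.sceneVariety 𝕜, Q.Projects S y

/-- `Q` is camera-minimal: the joint camera map is dominant, and a generic joint image is explained
by only finitely many camera configurations. -/
def IsCameraMinimal (Q : PL1P ι κ) (𝕜 : Type*) [Field 𝕜] : Prop :=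
  Q.IsDominant 𝕜 ∧
  GenericOn JointImage.HasCoords (Q.imageVariety 𝕜)
    fun y => {P | ∃ S ∈ Q.sceneVariety 𝕜, Q.Projects S y ∧ S.cam = P}.Finite

/-! ### Reduction -/

/-- The PL1P on the kept points and lines. -/
def restrict (Q : PL1P ι κ) (K : Kept ι κ) : PL1P K.pts K.lines where
  inc i j := Q.inc i j
  ptObs v := {i | (i : ι) ∈ Q.ptObs v}
  lineObs v := {j | (j : κ) ∈ Q.lineObs v}
  inc_unique i i' j h h' := Subtype.ext (Q.inc_unique i i' j h h')
  obs_meet v i j j' hj h h' ho ho' :=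
    Q.obs_meet v i j j' (fun e => hj (Subtype.ext e)) h h' ho ho'

/-- The forgetting map `Π` in space. -/
def forgetScene {𝕜 : Type*} [Field 𝕜] (K : Kept ι κ) (S : Scene 𝕜 ι κ) :
    Scene 𝕜 K.pts K.lines :=
  ⟨fun i => S.pt i, fun j => S.line j, S.cam⟩

/-- The forgetting map `π` in the views. -/
def forgetImage {𝕜 : Type*} [Field 𝕜] (Q : PL1P ι κ) (K : Kept ι κ) (y : JointImage 𝕜 Q) :
    JointImage 𝕜 (Q.restrict K) :=
  ⟨fun v i => y.pt v ⟨i.1.1, i.2⟩, fun v j => y.line v ⟨j.1.1, j.2⟩⟩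

/-- `Q` is reducible to its restriction to `K`: for each forgotten point at most one of its pins is
kept, and for a generic `S' ∈ 𝒳' × 𝒞` and a generic `y ∈ π⁻¹(Φ'(S'))` there is a solution of `Q`
for `y` that lifts `S'`. -/
def IsReducibleTo (Q : PL1P ι κ) (𝕜 : Type*) [Field 𝕜] (K : Kept ι κ) : Prop :=
  (∀ i ∉ K.pts, ∀ j ∈ K.lines, ∀ j' ∈ K.lines, Q.inc i j → Q.inc i j' → j = j') ∧
  GenericOn Scene.HasCoords ((Q.restrict K).sceneVariety 𝕜) fun S' =>
    ∃ y', (Q.restrict K).Projects S' y' ∧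
      GenericOn JointImage.HasCoords {y | y ∈ Q.imageVariety 𝕜 ∧ Q.forgetImage K y = y'} fun y =>
        ∃ S ∈ Q.sceneVariety 𝕜, Q.Projects S y ∧ forgetScene K S = S'

/-- `Q` is reduced: not reducible to another PL1P. -/
def IsReduced (Q : PL1P ι κ) (𝕜 : Type*) [Field 𝕜] : Prop :=
  ∀ K : Kept ι κ, Q.IsReducibleTo 𝕜 K → K = Kept.all

/-! ### The reduction rules -/

/-- The views that observe a point. -/
def ptViews (Q : PL1P ι κ) (i : ι) : Set (Fin 3) := {v | i ∈ Q.ptObs v}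

/-- The views that observe a line. -/
def lineViews (Q : PL1P ι κ) (j : κ) : Set (Fin 3) := {v | j ∈ Q.lineObs v}

/-- The kept pins of the point `i`. -/
def pins (Q : PL1P ι κ) (K : Kept ι κ) (i : ι) : Set κ := {j | j ∈ K.lines ∧ Q.inc i j}

/-- `j` is a kept line, and a free one after forgetting: it is incident to no kept point. -/
def IsFreeLine (Q : PL1P ι κ) (K : Kept ι κ) (j : κ) : Prop :=
  j ∈ K.lines ∧ ∀ i ∈ K.pts, ¬ Q.inc i j

/-- `j` is a kept line through the kept point `i`. -/
def IsPin (Q : PL1P ι κ) (K : Kept ι κ) (i : ι) (j : κ) : Prop :=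
  i ∈ K.pts ∧ j ∈ K.lines ∧ Q.inc i j

/-- `Q.Rule K K'`: one reduction rule, applied to the points and lines in `K`, leaves `K'`. -/
inductive Rule (Q : PL1P ι κ) (K : Kept ι κ) : Kept ι κ → Prop
  /-- a pin observed in exactly two views, both of which observe its point -/
  | pin_two (i : ι) (j : κ) : Q.IsPin K i j → (Q.lineViews j).ncard = 2 →
      Q.lineViews j ⊆ Q.ptViews i → Rule Q K (K.forget ∅ {j})
  /-- a free line observed in exactly two views -/
  | free_two (j : κ) : Q.IsFreeLine K j → (Q.lineViews j).ncard = 2 →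
      Rule Q K (K.forget ∅ {j})
  /-- a point with exactly one pin; all views observe the pin, and exactly one the point -/
  | point_of_full_pin (i : ι) (j : κ) : i ∈ K.pts → Q.pins K i = {j} →
      Q.lineViews j = Set.univ → (Q.ptViews i).ncard = 1 → Rule Q K (K.forget {i} ∅)
  /-- a point with its single pin; exactly two views observe the pin, and exactly one of these two,
  and no other view, observes the point -/
  | point_with_pin_two (i : ι) (j : κ) : i ∈ K.pts → Q.pins K i = {j} →
      (Q.lineViews j).ncard = 2 → (Q.ptViews i).ncard = 1 → Q.ptViews i ⊆ Q.lineViews j →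
      Rule Q K (K.forget {i} {j})
  /-- an unobserved line, free or pin -/
  | unobserved_line (j : κ) : j ∈ K.lines → Q.lineViews j = ∅ → Rule Q K (K.forget ∅ {j})
  /-- a free line observed in exactly one view -/
  | free_one (j : κ) : Q.IsFreeLine K j → (Q.lineViews j).ncard = 1 →
      Rule Q K (K.forget ∅ {j})
  /-- a pin observed in exactly one view, which also observes its point -/
  | pin_one (i : ι) (j : κ) : Q.IsPin K i j → (Q.lineViews j).ncard = 1 →
      Q.lineViews j ⊆ Q.ptViews i → Rule Q K (K.forget ∅ {j})
  /-- a point without pins observed in at most one view -/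
  | point_no_pin (i : ι) : i ∈ K.pts → Q.pins K i = ∅ → (Q.ptViews i).ncard ≤ 1 →
      Rule Q K (K.forget {i} ∅)
  /-- an unobserved point with exactly one pin; the pin becomes a free line -/
  | unobserved_point (i : ι) (j : κ) : i ∈ K.pts → Q.pins K i = {j} → Q.ptViews i = ∅ →
      Rule Q K (K.forget {i} ∅)
  /-- a point with its single pin; exactly one view observes the pin, and exactly one other view
  observes the point -/
  | point_with_pin_one (i : ι) (j : κ) : i ∈ K.pts → Q.pins K i = {j} →
      (Q.lineViews j).ncard = 1 → (Q.ptViews i).ncard = 1 →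
      Disjoint (Q.ptViews i) (Q.lineViews j) → Rule Q K (K.forget {i} {j})
  /-- an unobserved point with at least two pins, all of them observed, together with its pins -/
  | unobserved_point_with_pins (i : ι) : i ∈ K.pts → (Q.pins K i).Nontrivial →
      Q.ptViews i = ∅ → (∀ j ∈ Q.pins K i, (Q.lineViews j).Nonempty) →
      Rule Q K (K.forget {i} (Q.pins K i))

/-- `K` is what is left after applying reduction rules, one after the other and in some order, until
none of them applies any more. -/
def IsExhausted (Q : PL1P ι κ) (K : Kept ι κ) : Prop :=
  Relation.ReflTransGen Q.Rule Kept.all K ∧ ∀ K', ¬ Q.Rule K K'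

end PL1P

end PLP

namespace PLP

open Module Filter

/-! ### Linear algebra of subspaces and their images -/

section LinearAlgebra

variable {𝕜 : Type*} [Field 𝕜] {V W : Type*} [AddCommGroup V] [Module 𝕜 V] [AddCommGroup W]
  [Module 𝕜 W]

/-! Whether a feature can be forgotten is a count of conditions. A point of space has three
parameters. A view that observes it confines it to a ray (two conditions), and another view that
sees one of its pins confines it to a plane (one condition). A forgotten point without kept pins is
therefore overdetermined if two views observe it, or if one does and both other views see pins. A
pin seen in all three views escapes the second case: it is kept, and one observation of the point
fixes the point on it. A line has four parameters and each view that sees it costs two, so a line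
seen in three views must stay. A pin of a kept point must stay if some view sees it but not the
point: its image there need not pass through the image of the point.

These conditions define `core`, straight from the observation pattern. Three facts give existence
and uniqueness. Every set of kept features to which the problem is reducible contains the core
(`IsReducibleTo.core_subset`). The problem is reducible to its core (`isForgettable_core` with
`IsForgettable.isReducibleTo`). The core of the core is everything (`core_restrict_core`). If the
restriction to `K'` is reduced, it equals its own core, and since `K'` contains the core of `Q`, the
two coincide (`eq_core_of_core_restrict_eq_all`).

Necessity is proved by perturbation: in a fibre of the forgetting map, a forgotten image feature can
be moved until it contradicts what the other features impose on every lift (`movable_fiber`).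
Sufficiency is proved by intersecting rays and planes; away from the epipoles the solution avoids
the relevant camera centres, so its images have the right dimension (`exists_point_lift`,
`exists_line_lift`).

The rules are handled purely combinatorially. None of them removes a core feature
(`Rule.core_subset`), and one applies as long as a feature outside the core is kept
(`eq_core_of_no_rule`). Every maximal run thus ends at the core, and no composition of reductions is
needed. -/

theorem exists_mem_ne_zero_of_finrank_pos {L : Submodule 𝕜 V} (h : 0 < finrank 𝕜 L) :
    ∃ x ∈ L, x ≠ 0 :=
  L.exists_mem_ne_zero_of_ne_bot fun e => by rw [e, finrank_bot] at h; exact h.false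

theorem linearIndependent_of_finrank_span {k : ℕ} {b : Fin k → V}
    (h : finrank 𝕜 (Submodule.span 𝕜 (Set.range b)) = k) : LinearIndependent 𝕜 b :=
  linearIndependent_iff_card_eq_finrank_span.2 (by simp [Set.finrank, h])

variable [FiniteDimensional 𝕜 V]

theorem finrank_map_add_finrank_inf_ker (f : V →ₗ[𝕜] W) (L : Submodule 𝕜 V) :
    finrank 𝕜 (L.map f) + finrank 𝕜 (L ⊓ LinearMap.ker f : Submodule 𝕜 V) = finrank 𝕜 L := by
  rw [← LinearMap.finrank_range_add_finrank_ker (f.domRestrict L), LinearMap.range_domRestrict,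
    LinearMap.ker_domRestrict, ← Submodule.map_comap_subtype,
    Submodule.finrank_map_subtype_eq, ← LinearMap.ker_comp]

theorem finrank_comap_of_surjective {f : V →ₗ[𝕜] W} (hf : Function.Surjective f)
    (T : Submodule 𝕜 W) :
    finrank 𝕜 (T.comap f) = finrank 𝕜 T + finrank 𝕜 (LinearMap.ker f) := by
  rw [← finrank_map_add_finrank_inf_ker f (T.comap f), Submodule.map_comap_eq_of_surjective hf,
    inf_eq_right.2 (LinearMap.ker_le_comap f)]

theorem eq_zero_of_finrank_map_eq {f : V →ₗ[𝕜] W} {L : Submodule 𝕜 V}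
    (h : finrank 𝕜 (L.map f) = finrank 𝕜 L) {x : V} (hx : x ∈ L) (hx0 : f x = 0) : x = 0 := by
  have h1 := finrank_map_add_finrank_inf_ker f L
  have h2 : finrank 𝕜 (L ⊓ LinearMap.ker f : Submodule 𝕜 V) = 0 := by omega
  rw [Submodule.finrank_eq_zero] at h2
  have : x ∈ (L ⊓ LinearMap.ker f : Submodule 𝕜 V) := ⟨hx, hx0⟩
  rwa [h2, Submodule.mem_bot] at this

theorem finrank_map_eq_of_inf_ker {f : V →ₗ[𝕜] W} {L : Submodule 𝕜 V}
    (h : ∀ x ∈ L, f x = 0 → x = 0) : finrank 𝕜 (L.map f) = finrank 𝕜 L := by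
  have h1 := finrank_map_add_finrank_inf_ker f L
  have h2 : (L ⊓ LinearMap.ker f : Submodule 𝕜 V) = ⊥ :=
    (Submodule.eq_bot_iff _).2 fun x hx => h x hx.1 hx.2
  rw [h2, finrank_bot] at h1
  omega

theorem finrank_add_le_finrank_inf (L M : Submodule 𝕜 V) :
    finrank 𝕜 L + finrank 𝕜 M ≤ finrank 𝕜 (L ⊓ M : Submodule 𝕜 V) + finrank 𝕜 V := by
  have h1 := Submodule.finrank_sup_add_finrank_inf_eq L M
  have h2 := Submodule.finrank_le (L ⊔ M)
  omega

theorem exists_mem_notMem_of_finrank_lt {L M : Submodule 𝕜 V} (h : finrank 𝕜 M < finrank 𝕜 L) :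
    ∃ x ∈ L, x ∉ M := by
  by_contra! hc
  exact absurd (Submodule.finrank_mono (show L ≤ M from hc)) (by omega)

theorem eq_span_singleton_of_finrank_le_one {L : Submodule 𝕜 V} (h : finrank 𝕜 L ≤ 1) {x : V}
    (hx : x ∈ L) (hx0 : x ≠ 0) : L = Submodule.span 𝕜 {x} :=
  (Submodule.eq_of_le_of_finrank_le ((Submodule.span_singleton_le_iff_mem _ _).2 hx)
    (by rwa [finrank_span_singleton hx0])).symm

/-- A basis of a plane, as a pair of spanning vectors. -/
theorem exists_pair_of_finrank_eq_two {L : Submodule 𝕜 V} (h : finrank 𝕜 L = 2) :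
    ∃ b : Fin 2 → V, L = Submodule.span 𝕜 (Set.range b) := by
  let b := finBasisOfFinrankEq 𝕜 L h
  refine ⟨fun k => b k, ?_⟩
  have : Set.range (fun k => (b k : V)) = L.subtype '' Set.range b := by
    rw [← Set.range_comp]; rfl
  rw [this, Submodule.span_image, b.span_eq, Submodule.map_top, Submodule.range_subtype]

end LinearAlgebra

/-! ### Points and lines from subspaces -/

section Projective

variable {𝕜 : Type*} [Field 𝕜]

theorem exists_line_through {n : ℕ} (hn : 2 ≤ n) {x : Fin n → 𝕜} (hx : x ≠ 0) :
    ∃ L : Line 𝕜 n, x ∈ L.1 := by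
  obtain ⟨z, -, hz⟩ := exists_mem_notMem_of_finrank_lt (𝕜 := 𝕜) (L := (⊤ : Submodule 𝕜 (Fin n → 𝕜)))
    (M := Submodule.span 𝕜 {x}) (by rw [finrank_span_singleton hx, finrank_top]; simp; omega)
  have hli : LinearIndependent 𝕜 ![x, z] := by
    rw [LinearIndependent.pair_iff' hx]
    exact fun a ha => hz (Submodule.mem_span_singleton.2 ⟨a, ha⟩)
  exact ⟨⟨Submodule.span 𝕜 (Set.range ![x, z]), by rw [finrank_span_eq_card hli]; simp⟩,
    Submodule.subset_span ⟨0, rfl⟩⟩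

variable {f g : (Fin 4 → 𝕜) →ₗ[𝕜] (Fin 3 → 𝕜)}

theorem finrank_ker_of_surjective (hf : Function.Surjective f) :
    finrank 𝕜 (LinearMap.ker f) = 1 := by
  have := LinearMap.finrank_range_add_finrank_ker f
  rw [LinearMap.range_eq_top.2 hf, finrank_top] at this
  simp at this
  omega

/-- A second point of `l`, independent of `f x`, is lifted through `f`; together with `x` it spans
the required line. This lifts a forgotten line that only one view observes. -/
theorem exists_line_map_eq (hf : Function.Surjective f) (l : Line 𝕜 3) {x : Fin 4 → 𝕜}
    (hx : f x ∈ l.1) (hx0 : f x ≠ 0) : ∃ L : Line 𝕜 4, x ∈ L.1 ∧ L.1.map f = l.1 := by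
  obtain ⟨q, hq, hq'⟩ := exists_mem_notMem_of_finrank_lt (𝕜 := 𝕜) (L := l.1)
    (M := Submodule.span 𝕜 {f x}) (by rw [finrank_span_singleton hx0, l.2]; simp)
  obtain ⟨z, rfl⟩ := hf q
  have hli : LinearIndependent 𝕜 ![f x, f z] := by
    rw [LinearIndependent.pair_iff' hx0]
    exact fun a ha => hq' (Submodule.mem_span_singleton.2 ⟨a, ha⟩)
  have hli' : LinearIndependent 𝕜 ![x, z] := by
    apply LinearIndependent.of_comp f
    convert hli using 1
    ext k; fin_cases k <;> rfl
  refine ⟨⟨Submodule.span 𝕜 (Set.range ![x, z]), by rw [finrank_span_eq_card hli']; simp⟩,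
    Submodule.subset_span ⟨0, rfl⟩, ?_⟩
  apply Submodule.eq_of_le_of_finrank_eq
  · rw [Submodule.map_span, Submodule.span_le]
    rintro _ ⟨_, ⟨k, rfl⟩, rfl⟩
    fin_cases k
    exacts [hx, hq]
  · rw [l.2, Submodule.map_span, ← Set.range_comp]
    have : f ∘ ![x, z] = ![f x, f z] := by ext k; fin_cases k <;> rfl
    rw [this, finrank_span_eq_card hli]; simp

/-- The two back-projected planes have dimension 3 in a space of dimension 4, so they meet in
dimension at least 2. The hypotheses keep both camera centres out of the intersection, so both
projections are injective on it, and comparing dimensions makes them onto `l` and `m`. -/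
theorem exists_line_map_eq_map_eq (hf : Function.Surjective f) (hg : Function.Surjective g)
    (l m : Line 𝕜 3) (hfm : ∀ x, f x = 0 → g x ∈ m.1 → x = 0)
    (hgl : ∀ x, g x = 0 → f x ∈ l.1 → x = 0) :
    ∃ L : Line 𝕜 4, L.1 = l.1.comap f ⊓ m.1.comap g ∧ L.1.map f = l.1 ∧ L.1.map g = m.1 := by
  set L := l.1.comap f ⊓ m.1.comap g with hL
  have h1 := finrank_add_le_finrank_inf (l.1.comap f) (m.1.comap g)
  rw [finrank_comap_of_surjective hf, finrank_comap_of_surjective hg, l.2, m.2,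
    finrank_ker_of_surjective hf, finrank_ker_of_surjective hg, ← hL] at h1
  simp only [finrank_fin_fun] at h1
  have hfL : finrank 𝕜 (L.map f) = finrank 𝕜 L :=
    finrank_map_eq_of_inf_ker fun x hx h0 => hfm x h0 hx.2
  have hgL : finrank 𝕜 (L.map g) = finrank 𝕜 L :=
    finrank_map_eq_of_inf_ker fun x hx h0 => hgl x h0 hx.1
  have hfl : L.map f = l.1 := Submodule.eq_of_le_of_finrank_le
    (Submodule.map_le_iff_le_comap.2 inf_le_left) (by rw [l.2]; omega)
  have hgm : L.map g = m.1 := Submodule.eq_of_le_of_finrank_le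
    (Submodule.map_le_iff_le_comap.2 inf_le_right) (by rw [m.2]; omega)
  exact ⟨⟨L, by rw [← hfL, hfl, l.2]⟩, rfl, hfl, hgm⟩

/-- A line in the plane through a given point that avoids finitely many other points. -/
theorem exists_line_avoiding [Infinite 𝕜] {α : Type*} [Finite α] {p : Fin 3 → 𝕜} (hp : p ≠ 0)
    (e : α → Fin 3 → 𝕜) (he : ∀ a, e a ∉ Submodule.span 𝕜 {p}) :
    ∃ l : Line 𝕜 3, p ∈ l.1 ∧ ∀ a, e a ∉ l.1 := by
  -- the functionals vanishing at `p`
  let D : Submodule 𝕜 (Dual 𝕜 (Fin 3 → 𝕜)) := LinearMap.ker (Dual.eval 𝕜 _ p)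
  -- The extra vector `z` becomes the `none` entry below; `φ z ≠ 0` guarantees that `φ` is not zero.
  obtain ⟨z, -, hz⟩ := exists_mem_notMem_of_finrank_lt (𝕜 := 𝕜)
    (L := (⊤ : Submodule 𝕜 (Fin 3 → 𝕜))) (M := Submodule.span 𝕜 {p})
    (by rw [finrank_span_singleton hp, finrank_top]; simp)
  obtain ⟨φ, hφ, hφe⟩ := Module.Dual.exists_forall_mem_ne_zero_of_forall_exists D
    (fun a : Option α => Dual.eval 𝕜 _ (a.elim z e)) (by
      intro a
      have : a.elim z e ∉ Submodule.span 𝕜 {p} := by cases a <;> simp [hz, he]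
      obtain ⟨ψ, h1, h2⟩ := Submodule.exists_le_ker_of_notMem this
      exact ⟨ψ, h2 (Submodule.mem_span_singleton_self p), h1⟩)
  refine ⟨⟨LinearMap.ker φ, ?_⟩, hφ, fun a => hφe (some a)⟩
  have h1 := LinearMap.finrank_range_add_finrank_ker φ
  have h2 : LinearMap.range φ = ⊤ := LinearMap.range_eq_top.2
    (LinearMap.surjective (fun e0 => hφe none (by simp [e0])))
  rw [h2, finrank_top] at h1
  simp at h1
  omega

/-- A point on a given line in the plane that avoids finitely many other points. -/
theorem exists_point_avoiding [Infinite 𝕜] {α : Type*} [Finite α] (l : Line 𝕜 3)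
    (e : α → Fin 3 → 𝕜) (he : ∀ a, e a ≠ 0) :
    ∃ p ∈ l.1, p ≠ 0 ∧ ∀ a, e a ∉ Submodule.span 𝕜 {p} := by
  -- A plane over an infinite field is not a finite union of proper subspaces. The `none` entry
  -- contributes the zero subspace and yields `p ≠ 0`.
  obtain ⟨⟨p, hp⟩, h⟩ := Submodule.exists_forall_notMem_of_forall_ne_top (K := 𝕜) (M := l.1)
    (fun a : Option α => (Submodule.span 𝕜 {a.elim 0 e}).comap l.1.subtype) (by
      intro a hc
      have h1 : l.1 ≤ Submodule.span 𝕜 {a.elim 0 e} := by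
        rwa [← Submodule.comap_subtype_eq_top]
      have h2 := Submodule.finrank_mono h1
      rw [l.2] at h2
      have := finrank_span_le_card (R := 𝕜) ({a.elim 0 e} : Set (Fin 3 → 𝕜))
      simp at this
      omega)
  have hp0 : p ≠ 0 := fun e0 => h none (by simp [e0])
  refine ⟨p, hp, hp0, fun a ha => h (some a) ?_⟩
  obtain ⟨c, hc⟩ := Submodule.mem_span_singleton.1 ha
  have hc0 : c ≠ 0 := fun e0 => he a (by simp [← hc, e0])
  exact Submodule.mem_span_singleton.2 ⟨c⁻¹, by simp [← hc, hc0]⟩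

/-! ### Cameras -/

theorem mulVec_eq_camRot_add (P : Matrix (Fin 3) (Fin 4) 𝕜) (z : Fin 4 → 𝕜) :
    P.mulVec z = (camRot P).mulVec (fun k => z k.castSucc) + z (Fin.last 3) • camTrans P := by
  ext r
  simp [Matrix.mulVec, dotProduct, camRot, camTrans, Fin.sum_univ_castSucc, mul_comm]

/-- A vector that spans the centre of a calibrated camera. -/
def camCenter (P : Matrix (Fin 3) (Fin 4) 𝕜) : Fin 4 → 𝕜 :=
  Fin.snoc (α := fun _ => 𝕜) (-((camRot P).transpose.mulVec (camTrans P))) 1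

theorem camCenter_ne_zero (P : Matrix (Fin 3) (Fin 4) 𝕜) : camCenter P ≠ 0 := fun h => by
  simpa [camCenter, -Fin.reduceLast] using congrFun h (Fin.last 3)

theorem mulVec_camCenter {P : Fin 3 → Matrix (Fin 3) (Fin 4) 𝕜} (hP : P ∈ cameras 𝕜) (v : Fin 3) :
    (P v).mulVecLin (camCenter (P v)) = 0 := by
  rw [Matrix.mulVecLin_apply, mulVec_eq_camRot_add]
  have : (fun k : Fin 3 => camCenter (P v) k.castSucc) =
      -((camRot (P v)).transpose.mulVec (camTrans (P v))) := by
    ext k; simp [camCenter]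
  rw [this, Matrix.mulVec_neg, Matrix.mulVec_mulVec, (hP.1 v).1]
  simp [camCenter, -Fin.reduceLast]

theorem mulVecLin_surjective {P : Fin 3 → Matrix (Fin 3) (Fin 4) 𝕜} (hP : P ∈ cameras 𝕜)
    (v : Fin 3) : Function.Surjective (P v).mulVecLin := fun y => by
  refine ⟨Fin.snoc (α := fun _ => 𝕜) ((camRot (P v)).transpose.mulVec y) 0, ?_⟩
  rw [Matrix.mulVecLin_apply, mulVec_eq_camRot_add]
  simp [Matrix.mulVec_mulVec, (hP.1 v).1, -Fin.reduceLast]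

theorem eq_smul_camCenter {P : Fin 3 → Matrix (Fin 3) (Fin 4) 𝕜} (hP : P ∈ cameras 𝕜)
    (v : Fin 3) {x : Fin 4 → 𝕜} (hx : (P v).mulVecLin x = 0) : ∃ a : 𝕜, a • camCenter (P v) = x := by
  have h := eq_span_singleton_of_finrank_le_one
    (finrank_ker_of_surjective (mulVecLin_surjective hP v)).le
    (x := camCenter (P v)) (mulVec_camCenter hP v) (camCenter_ne_zero _)
  exact Submodule.mem_span_singleton.1 (h ▸ (show x ∈ LinearMap.ker (P v).mulVecLin from hx))

end Projective

/-! ### The core of a point-line problem, and how it behaves under restriction -/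

namespace PL1P

variable {ι κ : Type*} (Q : PL1P ι κ)

/-- The points and lines that remain after a complete reduction. -/
def core : Kept ι κ where
  pts := {i | ∃ v, i ∈ Q.ptObs v ∧ ((∃ w, w ≠ v ∧ i ∈ Q.ptObs w) ∨
    ((∀ w, w ≠ v → ∃ j, Q.inc i j ∧ j ∈ Q.lineObs w) ∧
      ∀ j, Q.inc i j → ∃ u, j ∉ Q.lineObs u))}
  -- The membership condition of `pts` is spelled out again here; `mem_core_lines` folds it back.
  lines := {j | (∀ v, j ∈ Q.lineObs v) ∨
    ∃ i, (∃ v, i ∈ Q.ptObs v ∧ ((∃ w, w ≠ v ∧ i ∈ Q.ptObs w) ∨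
    ((∀ w, w ≠ v → ∃ j, Q.inc i j ∧ j ∈ Q.lineObs w) ∧
      ∀ j, Q.inc i j → ∃ u, j ∉ Q.lineObs u))) ∧ Q.inc i j ∧
      ∃ v, j ∈ Q.lineObs v ∧ i ∉ Q.ptObs v}

variable {Q}

theorem mem_core_pts {i : ι} : i ∈ Q.core.pts ↔ ∃ v, i ∈ Q.ptObs v ∧
    ((∃ w, w ≠ v ∧ i ∈ Q.ptObs w) ∨
      ((∀ w, w ≠ v → ∃ j, Q.inc i j ∧ j ∈ Q.lineObs w) ∧
        ∀ j, Q.inc i j → ∃ u, j ∉ Q.lineObs u)) := Iff.rfl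

theorem mem_core_lines {j : κ} : j ∈ Q.core.lines ↔ (∀ v, j ∈ Q.lineObs v) ∨
    ∃ i ∈ Q.core.pts, Q.inc i j ∧ ∃ v, j ∈ Q.lineObs v ∧ i ∉ Q.ptObs v := Iff.rfl

variable (Q) in
-- The clause that could break by forgetting lines is the one asking for pins in the other views. If
-- the point is observed in one view only, those pins are seen where the point is not, so they are
-- themselves core lines and survive.
theorem core_restrict_core : (Q.restrict Q.core).core = Kept.all := by
  have hp : ∀ i : Q.core.pts, i ∈ (Q.restrict Q.core).core.pts := by
    rintro ⟨i, hi⟩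
    obtain ⟨v, hv, h⟩ := mem_core_pts.1 hi
    refine mem_core_pts.2 ⟨v, hv, ?_⟩
    by_cases hw : ∃ w, w ≠ v ∧ i ∈ Q.ptObs w
    · exact Or.inl hw
    obtain h | ⟨h1, h2⟩ := h
    · exact Or.inl h
    · refine Or.inr ⟨fun w hwv => ?_, fun j hj => h2 j hj⟩
      obtain ⟨j, hij, hj⟩ := h1 w hwv
      exact ⟨⟨j, mem_core_lines.2 (Or.inr ⟨i, hi, hij, w, hj, fun h => hw ⟨w, hwv, h⟩⟩)⟩, hij, hj⟩
  ext k
  · exact ⟨fun _ => trivial, fun _ => hp k⟩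
  · refine ⟨fun _ => trivial, fun _ => ?_⟩
    obtain h | ⟨i, hi, hij, h⟩ := mem_core_lines.1 k.2
    · exact mem_core_lines.2 (Or.inl h)
    · exact mem_core_lines.2 (Or.inr ⟨⟨i, hi⟩, hp _, hij, h⟩)

/-- Witnessing views and pins in the restriction are witnesses in `Q`. The clause about all pins
transfers because a pin seen in every view lies in the core of `Q` and hence in `K`. -/
theorem eq_core_of_core_restrict_eq_all {K : Kept ι κ} (hp : Q.core.pts ⊆ K.pts)
    (hl : Q.core.lines ⊆ K.lines) (hK : (Q.restrict K).core = Kept.all) : K = Q.core := by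
  have hp' : K.pts ⊆ Q.core.pts := by
    intro i hi
    have h : (⟨i, hi⟩ : K.pts) ∈ (Q.restrict K).core.pts := hK ▸ trivial
    obtain ⟨v, hv, h⟩ := mem_core_pts.1 h
    refine mem_core_pts.2 ⟨v, hv, ?_⟩
    refine h.imp id fun ⟨h1, h2⟩ => ⟨fun w hw => ?_, fun j hj => ?_⟩
    · obtain ⟨j, hj⟩ := h1 w hw
      exact ⟨j, hj⟩
    · by_contra! hc
      obtain ⟨u, hu⟩ := h2 ⟨j, hl (mem_core_lines.2 (Or.inl hc))⟩ hj
      exact hu (hc u)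
  refine Kept.ext (hp'.antisymm hp) (Set.Subset.antisymm ?_ hl)
  intro j hj
  have h : (⟨j, hj⟩ : K.lines) ∈ (Q.restrict K).core.lines := hK ▸ trivial
  obtain h | ⟨i, -, h⟩ := mem_core_lines.1 h
  · exact mem_core_lines.2 (Or.inl h)
  · exact mem_core_lines.2 (Or.inr ⟨i, hp' i.2, h⟩)

/-- A point with a pin observed in all views is observed wherever another pin is. -/
theorem mem_ptObs_of_full_pin {i : ι} {j j' : κ} (hj : Q.inc i j) (hj' : Q.inc i j')
    (hne : j ≠ j') (hfull : ∀ v, j ∈ Q.lineObs v) {v : Fin 3} (hv : j' ∈ Q.lineObs v) :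
    i ∈ Q.ptObs v :=
  Q.obs_meet v i j j' hne hj hj' (hfull v) hv

theorem mem_core_lines_of_pin {i : ι} {j : κ} (hi : i ∈ Q.core.pts) (hij : Q.inc i j)
    {v : Fin 3} (hv : j ∈ Q.lineObs v) (hiv : i ∉ Q.ptObs v) : j ∈ Q.core.lines :=
  mem_core_lines.2 (Or.inr ⟨i, hi, hij, v, hv, hiv⟩)

theorem notMem_core_lines_of_pin {i : ι} {j : κ} (hij : Q.inc i j)
    (hsub : Q.lineViews j ⊆ Q.ptViews i) (hne : Q.lineViews j ≠ Set.univ) :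
    j ∉ Q.core.lines := by
  intro h
  obtain h | ⟨i', -, h', v, hv, hv'⟩ := mem_core_lines.1 h
  · exact hne (Set.eq_univ_of_forall h)
  · obtain rfl := Q.inc_unique i i' j hij h'
    exact hv' (hsub hv)

theorem ncard_lineViews_ne {j : κ} (h : (Q.lineViews j).ncard ≠ 3) :
    Q.lineViews j ≠ Set.univ := by
  intro e; rw [e] at h; simp [Set.ncard_univ] at h

theorem notMem_core_lines_of_notMem {j : κ} (hne : Q.lineViews j ≠ Set.univ)
    (h : ∀ i ∈ Q.core.pts, ¬ Q.inc i j) : j ∉ Q.core.lines := by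
  intro hj
  obtain h' | ⟨i, hi, hij, -⟩ := mem_core_lines.1 hj
  · exact hne (Set.eq_univ_of_forall h')
  · exact h i hi hij

theorem notMem_core_pts_of_empty {i : ι} (h : Q.ptViews i = ∅) : i ∉ Q.core.pts := by
  rintro ⟨v, hv, -⟩
  exact (h ▸ (show v ∈ Q.ptViews i from hv) : v ∈ (∅ : Set (Fin 3)))

/-- A point observed in one view only, such that the other pins than `j` (if kept) are gone, is not
in the core if `j` adds at most one view. -/
theorem notMem_core_pts_of_single {K : Kept ι κ} (hl : Q.core.lines ⊆ K.lines) {i : ι} {v : Fin 3}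
    (hv : Q.ptViews i = {v}) {w : Fin 3} (hw : ∀ j ∈ Q.pins K i, Q.lineViews j ⊆ {v, w}) :
    i ∉ Q.core.pts := by
  intro hi
  obtain ⟨v', hv', h⟩ := mem_core_pts.1 hi
  have hview : ∀ u, i ∈ Q.ptObs u → u = v := fun u hu => by
    have : u ∈ Q.ptViews i := hu
    rwa [hv] at this
  obtain rfl := hview v' hv'
  obtain ⟨u, hu, hiu⟩ | ⟨h1, -⟩ := h
  · exact hu (hview u hiu)
  · obtain ⟨u, huv, huw⟩ : ∃ u, u ≠ v' ∧ u ≠ w := by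
      clear * -
      revert v' w; decide
    obtain ⟨j, hij, hj⟩ := h1 u huv
    have hjc := mem_core_lines_of_pin hi hij hj fun h => huv (hview u h)
    obtain h | h := hw j ⟨hl hjc, hij⟩ hj
    · exact huv h
    · exact huw h

/-! ### The reduction rules and the core -/

/-- The invariant of every run of the rules. The rules speak of kept features and the core of all
features; that the core is still kept ensures that the pins which matter are visible to the rule. -/
theorem Rule.core_subset {K K' : Kept ι κ} (h : Q.Rule K K') (hp : Q.core.pts ⊆ K.pts)
    (hl : Q.core.lines ⊆ K.lines) : Q.core.pts ⊆ K'.pts ∧ Q.core.lines ⊆ K'.lines := by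
  have del : ∀ (A : Set ι) (B : Set κ), (∀ i ∈ A, i ∉ Q.core.pts) → (∀ j ∈ B, j ∉ Q.core.lines) →
      Q.core.pts ⊆ (K.forget A B).pts ∧ Q.core.lines ⊆ (K.forget A B).lines :=
    fun A B hA hB => ⟨fun i hi => ⟨hp hi, fun h => hA i h hi⟩, fun j hj => ⟨hl hj, fun h => hB j h hj⟩⟩
  cases h with
  | pin_two i j hij h2 hsub =>
    refine del _ _ (by simp) ?_
    rintro _ rfl
    exact notMem_core_lines_of_pin hij.2.2 hsub (ncard_lineViews_ne (by omega))
  | free_two j hj h2 =>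
    refine del _ _ (by simp) ?_
    rintro _ rfl
    exact notMem_core_lines_of_notMem (ncard_lineViews_ne (by omega)) fun i hi => hj.2 i (hp hi)
  | point_of_full_pin i j hi hpins hfull h1 =>
    suffices hi' : i ∉ Q.core.pts from del _ _ (by simpa using hi') (by simp)
    intro hc
    obtain ⟨v, hv, h⟩ := mem_core_pts.1 hc
    obtain ⟨v0, hv0⟩ := Set.ncard_eq_one.1 h1
    have hview : ∀ u, i ∈ Q.ptObs u → u = v0 := fun u hu => by
      have : u ∈ Q.ptViews i := hu
      rwa [hv0] at this
    have hij : j ∈ Q.pins K i := hpins ▸ rfl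
    obtain ⟨w, hw, hiw⟩ | ⟨-, h2⟩ := h
    · exact hw ((hview w hiw).trans (hview v hv).symm)
    · obtain ⟨u, hu⟩ := h2 j hij.2
      exact hu (show u ∈ Q.lineViews j from hfull ▸ trivial)
  | point_with_pin_two i j hi hpins h2 h1 hsub =>
    obtain ⟨v, hv⟩ := Set.ncard_eq_one.1 h1
    have hij : j ∈ Q.pins K i := hpins ▸ rfl
    obtain ⟨w, hw⟩ : ∃ w, Q.lineViews j ⊆ {v, w} := by
      obtain ⟨a, b, hab, he⟩ := Set.ncard_eq_two.1 h2
      rw [hv, he] at hsub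
      obtain h | h := hsub rfl
      · exact ⟨b, by rw [he, h]⟩
      · exact ⟨a, by rw [he, Set.pair_comm, ← Set.mem_singleton_iff.1 h]⟩
    have hi' : i ∉ Q.core.pts := notMem_core_pts_of_single hl hv (w := w) (by simpa [hpins] using hw)
    refine del _ _ (by simpa using hi') ?_
    rintro _ rfl
    refine notMem_core_lines_of_notMem (ncard_lineViews_ne (by omega)) fun i' hi'' h => hi' ?_
    rwa [Q.inc_unique i i' _ hij.2 h]
  | unobserved_line j hj h0 =>
    refine del _ _ (by simp) ?_
    rintro _ rfl h
    obtain h | ⟨-, -, -, v, h, -⟩ := mem_core_lines.1 h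
    · exact (h0 ▸ (show (0 : Fin 3) ∈ Q.lineViews _ from h 0) : (0 : Fin 3) ∈ (∅ : Set (Fin 3)))
    · exact (h0 ▸ (show v ∈ Q.lineViews _ from h) : v ∈ (∅ : Set (Fin 3)))
  | free_one j hj h1 =>
    refine del _ _ (by simp) ?_
    rintro _ rfl
    exact notMem_core_lines_of_notMem (ncard_lineViews_ne (by omega)) fun i hi => hj.2 i (hp hi)
  | pin_one i j hij h1 hsub =>
    refine del _ _ (by simp) ?_
    rintro _ rfl
    exact notMem_core_lines_of_pin hij.2.2 hsub (ncard_lineViews_ne (by omega))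
  | point_no_pin i hi hpins h1 =>
    refine del _ _ ?_ (by simp)
    rintro _ rfl
    rcases Nat.le_one_iff_eq_zero_or_eq_one.1 h1 with h | h
    · exact notMem_core_pts_of_empty ((Set.ncard_eq_zero).1 h)
    · obtain ⟨v, hv⟩ := Set.ncard_eq_one.1 h
      exact notMem_core_pts_of_single hl hv (w := v) (by simp [hpins])
  | unobserved_point i j hi hpins h0 =>
    exact del _ _ (by simpa using notMem_core_pts_of_empty h0) (by simp)
  | point_with_pin_one i j hi hpins h1 h1' hd =>
    obtain ⟨v, hv⟩ := Set.ncard_eq_one.1 h1'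
    obtain ⟨w, hw⟩ := Set.ncard_eq_one.1 h1
    have hij : j ∈ Q.pins K i := hpins ▸ rfl
    have hi' : i ∉ Q.core.pts := notMem_core_pts_of_single hl hv (w := w) (by simp [hpins, hw])
    refine del _ _ (by simpa using hi') ?_
    rintro _ rfl
    refine notMem_core_lines_of_notMem (ncard_lineViews_ne (by omega)) fun i' hi'' h => hi' ?_
    rwa [Q.inc_unique i i' _ hij.2 h]
  | unobserved_point_with_pins i hi hnt h0 hobs =>
    have hi' := notMem_core_pts_of_empty h0
    refine del _ _ (by simpa using hi') ?_
    intro j hj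
    refine notMem_core_lines_of_notMem (fun hu => ?_) fun i' hi'' h => hi' ?_
    -- If one pin were seen in all views, a view that sees a second pin would see two pins and hence
    -- observe their common point, which no view does.
    · obtain ⟨j', hj', hne⟩ := hnt.exists_ne j
      obtain ⟨v, hv⟩ := hobs j' hj'
      have : v ∈ Q.ptViews i := Q.obs_meet v i j j' hne.symm hj.2 hj'.2
        (show v ∈ Q.lineViews j from hu ▸ trivial) hv
      rw [h0] at this
      exact this
    · rwa [Q.inc_unique i i' _ hj.2 h]

/-- A pin that can be forgotten while its point is kept. -/
theorem exists_rule_of_pin {K : Kept ι κ} {i : ι} {j : κ} (hij : Q.IsPin K i j)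
    (hsub : Q.lineViews j ⊆ Q.ptViews i) (hne : Q.lineViews j ≠ Set.univ) :
    ∃ K', Q.Rule K K' := by
  have h3 : (Q.lineViews j).ncard < 3 := by
    have := Set.ncard_lt_card hne
    simpa using this
  obtain h | h | h : (Q.lineViews j).ncard = 0 ∨ (Q.lineViews j).ncard = 1 ∨
    (Q.lineViews j).ncard = 2 := by omega
  · exact ⟨_, .unobserved_line j hij.2.1 ((Set.ncard_eq_zero).1 h)⟩
  · exact ⟨_, .pin_one i j hij h hsub⟩
  · exact ⟨_, .pin_two i j hij h hsub⟩

theorem exists_rule_of_freeLine {K : Kept ι κ} {j : κ} (hj : Q.IsFreeLine K j)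
    (hne : Q.lineViews j ≠ Set.univ) : ∃ K', Q.Rule K K' := by
  have h3 : (Q.lineViews j).ncard < 3 := by
    have := Set.ncard_lt_card hne
    simpa using this
  obtain h | h | h : (Q.lineViews j).ncard = 0 ∨ (Q.lineViews j).ncard = 1 ∨
    (Q.lineViews j).ncard = 2 := by omega
  · exact ⟨_, .unobserved_line j hj.1 ((Set.ncard_eq_zero).1 h)⟩
  · exact ⟨_, .free_one j hj h⟩
  · exact ⟨_, .free_two j hj h⟩

/-- As long as a point outside the core is kept, some rule applies. -/
theorem exists_rule_of_point {K : Kept ι κ} (hl : Q.core.lines ⊆ K.lines) {i : ι}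
    (hi : i ∈ K.pts) (hic : i ∉ Q.core.pts) : ∃ K', Q.Rule K K' := by
  by_contra hno
  have hpin : ∀ j ∈ Q.pins K i, Q.lineViews j ⊆ Q.ptViews i → Q.lineViews j = Set.univ := by
    intro j hj hsub
    by_contra hne
    exact hno (exists_rule_of_pin ⟨hi, hj.1, hj.2⟩ hsub hne)
  have hobs : ∀ j ∈ Q.pins K i, (Q.lineViews j).Nonempty := by
    intro j hj
    rw [Set.nonempty_iff_ne_empty]
    exact fun h => hno ⟨_, .unobserved_line j hj.1 h⟩
  obtain h0 | ⟨v, hv⟩ := (Q.ptViews i).eq_empty_or_nonempty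
  · obtain hp | ⟨j, hj⟩ := (Q.pins K i).eq_empty_or_nonempty
    · exact hno ⟨_, .point_no_pin i hi hp (by simp [h0])⟩
    · by_cases hs : (Q.pins K i).Nontrivial
      · exact hno ⟨_, .unobserved_point_with_pins i hi hs h0 hobs⟩
      · rw [Set.not_nontrivial_iff] at hs
        exact hno ⟨_, .unobserved_point i j hi (hs.eq_singleton_of_mem hj) h0⟩
  · have hview : ∀ w, w ≠ v → i ∉ Q.ptObs w := fun w hw h =>
      hic (mem_core_pts.2 ⟨v, hv, Or.inl ⟨w, hw, h⟩⟩)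
    have hvs : Q.ptViews i = {v} := Set.eq_singleton_iff_unique_mem.2
      ⟨hv, fun w hw => by_contra fun h => hview w h hw⟩
    have h1 : (Q.ptViews i).ncard = 1 := by simp [hvs]
    by_cases hf : ∃ j, Q.inc i j ∧ ∀ u, j ∈ Q.lineObs u
    · obtain ⟨j, hij, hf⟩ := hf
      have hjK : j ∈ Q.pins K i := ⟨hl (mem_core_lines.2 (Or.inl hf)), hij⟩
      -- Any other kept pin is seen only where the point is, that is in `v` at most, so a pin rule
      -- would already remove it. The full pin is thus the single pin.
      refine hno ⟨_, .point_of_full_pin i j hi ?_ (Set.eq_univ_of_forall hf) h1⟩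
      refine Set.eq_singleton_iff_unique_mem.2 ⟨hjK, fun j' hj' => ?_⟩
      by_contra hne
      have hs : Q.lineViews j' ⊆ Q.ptViews i := fun u hu =>
        mem_ptObs_of_full_pin hij hj'.2 (Ne.symm hne) hf hu
      have := hpin j' hj' hs
      rw [this, hvs] at hs
      obtain ⟨w, hw⟩ : ∃ w : Fin 3, w ≠ v := exists_ne v
      exact hw (hs (Set.mem_univ w))
    · push Not at hf
      -- As the point is outside the core and has no full pin, some view `w` sees none of its pins.
      -- Let `u` be the third view. A kept pin not seen in `u` could be seen only in `v`, where a
      -- rule removes it; two pins seen in `u` would make the point observed there. So at most one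
      -- pin is left.
      obtain ⟨w, hwv, hw⟩ : ∃ w, w ≠ v ∧ ∀ j, Q.inc i j → j ∉ Q.lineObs w := by
        by_contra! hc
        exact hic (mem_core_pts.2 ⟨v, hv, Or.inr ⟨hc, hf⟩⟩)
      obtain ⟨u, huv, huw⟩ : ∃ u, u ≠ v ∧ u ≠ w := by
        clear * -
        revert v w; decide
      have hall : ∀ a, a = v ∨ a = w ∨ a = u := by
        clear * - hwv huv huw
        revert v w u; decide
      have hu : ∀ j ∈ Q.pins K i, j ∈ Q.lineObs u := by
        intro j hj
        by_contra hju
        have hs : Q.lineViews j ⊆ Q.ptViews i := by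
          intro a ha
          obtain rfl | rfl | rfl := hall a
          exacts [hv, absurd ha (hw j hj.2), absurd ha hju]
        obtain ⟨a, ha⟩ := hf j hj.2
        exact ha (show a ∈ Q.lineViews j from hpin j hj hs ▸ trivial)
      obtain hp | ⟨j, hj⟩ := (Q.pins K i).eq_empty_or_nonempty
      · exact hno ⟨_, .point_no_pin i hi hp h1.le⟩
      · have hpj : Q.pins K i = {j} := by
          refine Set.eq_singleton_iff_unique_mem.2 ⟨hj, fun j' hj' => ?_⟩
          by_contra hne
          exact hview u huv (Q.obs_meet u i j' j hne hj'.2 hj.2 (hu j' hj') (hu j hj))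
        by_cases hjv : j ∈ Q.lineObs v
        · refine hno ⟨_, .point_with_pin_two i j hi hpj ?_ h1 ?_⟩
          · have : Q.lineViews j = {v, u} := by
              ext a
              refine ⟨fun ha => ?_, ?_⟩
              · obtain rfl | rfl | rfl := hall a
                exacts [Or.inl rfl, absurd ha (hw j hj.2), Or.inr rfl]
              · rintro (rfl | rfl)
                exacts [hjv, hu j hj]
            rw [this, Set.ncard_pair huv.symm]
          · rw [hvs]
            rintro _ rfl
            exact hjv
        · have : Q.lineViews j = {u} := by
            ext a
            refine ⟨fun ha => ?_, ?_⟩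
            · obtain rfl | rfl | rfl := hall a
              exacts [absurd ha hjv, absurd ha (hw j hj.2), rfl]
            · rintro rfl
              exact hu j hj
          refine hno ⟨_, .point_with_pin_one i j hi hpj (by simp [this]) h1 ?_⟩
          rw [this, hvs]
          simpa using huv.symm

/-- Points come first: once all kept points are core points, a surplus kept line is either free or a
pin seen only where its point is, and is not seen in all views, so a rule for lines removes it. -/
theorem eq_core_of_no_rule {K : Kept ι κ} (hp : Q.core.pts ⊆ K.pts) (hl : Q.core.lines ⊆ K.lines)
    (hno : ∀ K', ¬ Q.Rule K K') : K = Q.core := by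
  have hp' : K.pts ⊆ Q.core.pts := by
    intro i hi
    by_contra hic
    obtain ⟨K', h⟩ := exists_rule_of_point hl hi hic
    exact hno K' h
  refine Kept.ext (hp'.antisymm hp) (Set.Subset.antisymm ?_ hl)
  intro j hj
  by_contra hjc
  have hne : Q.lineViews j ≠ Set.univ := fun h =>
    hjc (mem_core_lines.2 (Or.inl fun v => show v ∈ Q.lineViews j from h ▸ trivial))
  by_cases hf : ∃ i ∈ K.pts, Q.inc i j
  · obtain ⟨i, hi, hij⟩ := hf
    obtain ⟨K', h⟩ := exists_rule_of_pin ⟨hi, hj, hij⟩ (fun v hv => by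
      by_contra hiv
      exact hjc (mem_core_lines_of_pin (hp' hi) hij hv hiv)) hne
    exact hno K' h
  · push Not at hf
    obtain ⟨K', h⟩ := exists_rule_of_freeLine ⟨hj, hf⟩ hne
    exact hno K' h

theorem core_subset_of_reflTransGen {K : Kept ι κ}
    (h : Relation.ReflTransGen Q.Rule Kept.all K) :
    Q.core.pts ⊆ K.pts ∧ Q.core.lines ⊆ K.lines := by
  induction h with
  | refl => exact ⟨Set.subset_univ _, Set.subset_univ _⟩
  | tail _ h ih => exact h.core_subset ih.1 ih.2

theorem IsExhausted.eq_core {K : Kept ι κ} (h : Q.IsExhausted K) : K = Q.core :=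
  have h' := core_subset_of_reflTransGen h.1
  eq_core_of_no_rule h'.1 h'.2 h.2

/-- Termination: the number of kept features is the decreasing measure. -/
theorem Rule.ncard_lt [Finite ι] [Finite κ] {K K' : Kept ι κ} (h : Q.Rule K K') :
    K'.pts.ncard + K'.lines.ncard < K.pts.ncard + K.lines.ncard := by
  have del : ∀ (A : Set ι) (B : Set κ), ((∃ i ∈ K.pts, i ∈ A) ∨ ∃ j ∈ K.lines, j ∈ B) →
      (K.forget A B).pts.ncard + (K.forget A B).lines.ncard < K.pts.ncard + K.lines.ncard := by
    rintro A B (⟨i, hi, hA⟩ | ⟨j, hj, hB⟩)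
    · have h1 : (K.pts \ A).ncard < K.pts.ncard :=
        Set.ncard_lt_ncard ⟨Set.sdiff_subset, fun h => (h hi).2 hA⟩
      have h2 : (K.lines \ B).ncard ≤ K.lines.ncard := Set.ncard_le_ncard Set.sdiff_subset
      exact add_lt_add_of_lt_of_le h1 h2
    · have h1 : (K.pts \ A).ncard ≤ K.pts.ncard := Set.ncard_le_ncard Set.sdiff_subset
      have h2 : (K.lines \ B).ncard < K.lines.ncard :=
        Set.ncard_lt_ncard ⟨Set.sdiff_subset, fun h => (h hj).2 hB⟩
      exact add_lt_add_of_le_of_lt h1 h2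
  cases h with
  | pin_two i j hij => exact del _ _ (Or.inr ⟨j, hij.2.1, rfl⟩)
  | free_two j hj => exact del _ _ (Or.inr ⟨j, hj.1, rfl⟩)
  | point_of_full_pin i j hi => exact del _ _ (Or.inl ⟨i, hi, rfl⟩)
  | point_with_pin_two i j hi => exact del _ _ (Or.inl ⟨i, hi, rfl⟩)
  | unobserved_line j hj => exact del _ _ (Or.inr ⟨j, hj, rfl⟩)
  | free_one j hj => exact del _ _ (Or.inr ⟨j, hj.1, rfl⟩)
  | pin_one i j hij => exact del _ _ (Or.inr ⟨j, hij.2.1, rfl⟩)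
  | point_no_pin i hi => exact del _ _ (Or.inl ⟨i, hi, rfl⟩)
  | unobserved_point i j hi => exact del _ _ (Or.inl ⟨i, hi, rfl⟩)
  | point_with_pin_one i j hi => exact del _ _ (Or.inl ⟨i, hi, rfl⟩)
  | unobserved_point_with_pins i hi => exact del _ _ (Or.inl ⟨i, hi, rfl⟩)

variable (Q) in
-- Termination produces some exhausted outcome, and `IsExhausted.eq_core` identifies it; no explicit
-- sequence of rules has to be exhibited.
theorem isExhausted_core [Finite ι] [Finite κ] : Q.IsExhausted Q.core := by
  have key : ∀ (n : ℕ) (K : Kept ι κ), K.pts.ncard + K.lines.ncard = n →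
      Relation.ReflTransGen Q.Rule Kept.all K → ∃ K', Q.IsExhausted K' := by
    intro n
    induction n using Nat.strong_induction_on with
    | _ n ih =>
      intro K hn hK
      by_cases h : ∃ K', Q.Rule K K'
      · obtain ⟨K', h⟩ := h
        exact ih _ (hn ▸ h.ncard_lt) K' rfl (hK.tail h)
      · exact ⟨K, hK, not_exists.1 h⟩
  obtain ⟨K, hK⟩ := key _ Kept.all rfl Relation.ReflTransGen.refl
  exact hK.eq_core ▸ hK

end PL1P

/-! ### Moving the forgotten features of a joint image -/

section Moving

variable {𝕜 : Type*} [Field 𝕜] {V : Type*} [AddCommGroup V] [Module 𝕜 V]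

/-- On the line `s ↦ a + s • b` the polynomial `G` becomes a polynomial in `s` that does not vanish
at `s = 0`, so it has finitely many roots. -/
theorem eventually_eval_add_smul_ne_zero {σ : Type*} {G : MvPolynomial σ 𝕜} {a : σ → 𝕜}
    (h : MvPolynomial.eval a G ≠ 0) (b : σ → 𝕜) :
    ∀ᶠ s : 𝕜 in cofinite, MvPolynomial.eval (a + s • b) G ≠ 0 := by
  let p : Polynomial 𝕜 := MvPolynomial.aeval
    (fun k => Polynomial.C (a k) + Polynomial.X * Polynomial.C (b k)) G
  have hp : ∀ s, p.eval s = MvPolynomial.eval (a + s • b) G := by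
    intro s
    have := MvPolynomial.eval₂_comp_left (Polynomial.evalRingHom s) Polynomial.C
      (fun k => Polynomial.C (a k) + Polynomial.X * Polynomial.C (b k)) G
    simp only [p, MvPolynomial.aeval_def, Polynomial.algebraMap_eq]
    rw [Polynomial.coe_evalRingHom] at this
    rw [this, MvPolynomial.eval, MvPolynomial.coe_eval₂Hom]
    congr 1
    · ext x; simp
    · ext k; simpa using mul_comm _ _
  have hp0 : p ≠ 0 := by
    intro h0
    apply h
    rw [← add_zero a, ← zero_smul 𝕜 b, ← hp, h0, Polynomial.eval_zero]
  rw [eventually_cofinite]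
  refine (Polynomial.finite_setOfPred_isRoot hp0).subset fun s hs => ?_
  rw [Set.mem_ofPred_eq, not_not] at hs
  exact (hp s).trans hs

/-- A kernel vector of `1 + s • M` is an eigenvector of `M` for `-s⁻¹`, and there are finitely many
eigenvalues. -/
theorem eventually_injective_one_add_smul [FiniteDimensional 𝕜 V] (M : End 𝕜 V) :
    ∀ᶠ s : 𝕜 in cofinite, Function.Injective (1 + s • M : End 𝕜 V) := by
  rw [eventually_cofinite]
  refine (M.finite_hasEigenvalue.preimage (f := fun s : 𝕜 => -s⁻¹)
    (fun a _ b _ h => inv_injective (neg_injective h))).subset fun s hs => ?_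
  rw [Set.mem_ofPred_eq, ← LinearMap.ker_eq_bot, Submodule.eq_bot_iff] at hs
  push Not at hs
  obtain ⟨x, hx, hx0⟩ := hs
  have hx' : x + s • M x = 0 := hx
  have hs0 : s ≠ 0 := fun h => hx0 (by simpa [h] using hx')
  refine End.hasEigenvalue_of_hasEigenvector (x := x) ⟨End.mem_eigenspace_iff.2 ?_, hx0⟩
  rw [neg_smul, eq_neg_iff_add_eq_zero]
  have := congrArg (s⁻¹ • ·) hx'
  simpa [smul_smul, hs0, add_comm] using this

end Moving

namespace PL1P

variable {𝕜 : Type*} [Field 𝕜] {ι κ : Type*} {Q : PL1P ι κ} {K : Kept ι κ}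

/-- The forgotten features of the joint images in `U` can be moved, within `U`, by linear maps
that are compatible with the incidences and fix the kept features. -/
def Movable (K : Kept ι κ) (U : Set (JointImage 𝕜 Q)) : Prop :=
  ∀ y ∈ U, ∀ (Mp : Fin 3 → ι → End 𝕜 (Fin 3 → 𝕜)) (Ml : Fin 3 → κ → End 𝕜 (Fin 3 → 𝕜)),
    (∀ v (i : Q.ptObs v) (j : Q.lineObs v), Q.inc i j →
      ∀ x ∈ (y.pt v i).submodule, Mp v i x = Ml v j x) →
    (∀ v, ∀ i ∈ K.pts, Mp v i = 0) →
    (∀ v (j : Q.lineObs v), (j : κ) ∈ K.lines → (y.line v j).1.map (Ml v j) ≤ (y.line v j).1) →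
    ∀ᶠ s : 𝕜 in cofinite, ∃ y₁ ∈ U,
      (∀ v i, (y₁.pt v i).submodule = (y.pt v i).submodule.map (1 + s • Mp v i)) ∧
      ∀ v j, (y₁.line v j).1 = (y.line v j).1.map (1 + s • Ml v j)

/-- Applying `1 + s • M` to every feature moves the homogeneous coordinates along a line, so `G`
stays nonzero for almost all `s`. Incidences survive because the maps of a point and of a line
through it agree on the point. A kept line is mapped into itself, hence onto itself by injectivity.
-/
theorem movable_fiber [Finite ι] [Finite κ] (y' : JointImage 𝕜 (Q.restrict K))
    (G : MvPolynomial _ 𝕜) :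
    Movable K {y : JointImage 𝕜 Q | (y ∈ Q.imageVariety 𝕜 ∧ Q.forgetImage K y = y') ∧
      ∃ d, y.HasCoords d ∧ MvPolynomial.eval d G ≠ 0} := by
  rintro y ⟨⟨hy, hyK⟩, d, hd, hG⟩ Mp Ml hinc hkp hkl
  have hinjp : ∀ᶠ s : 𝕜 in cofinite, ∀ v i,
      Function.Injective (1 + s • Mp v i : End 𝕜 (Fin 3 → 𝕜)) :=
    eventually_all.2 fun v => eventually_all.2 fun i => eventually_injective_one_add_smul _
  have hinjl : ∀ᶠ s : 𝕜 in cofinite, ∀ v j,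
      Function.Injective (1 + s • Ml v j : End 𝕜 (Fin 3 → 𝕜)) :=
    eventually_all.2 fun v => eventually_all.2 fun i => eventually_injective_one_add_smul _
  filter_upwards [hinjp, hinjl, eventually_eval_add_smul_ne_zero hG
    (Sum.elim (fun k => Mp k.1.1 k.1.2 (fun a => d (Sum.inl (k.1, a))) k.2)
      (fun k => Ml k.1.1 k.1.2 (fun a => d (Sum.inr (k.1, k.2.1, a))) k.2.2))] with s hp hl hs
  have hrank : ∀ (f : End 𝕜 (Fin 3 → 𝕜)) (W : Submodule 𝕜 (Fin 3 → 𝕜)), Function.Injective f →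
      finrank 𝕜 (W.map f) = finrank 𝕜 W := fun f W hf =>
    finrank_map_eq_of_inf_ker fun x _ hx => hf (hx.trans (map_zero f).symm)
  let y₁ : JointImage 𝕜 Q :=
    ⟨fun v i => Projectivization.mk'' ((y.pt v i).submodule.map (1 + s • Mp v i))
      ((hrank _ _ (hp v i)).trans (y.pt v i).finrank_submodule),
     fun v j => ⟨(y.line v j).1.map (1 + s • Ml v j), (hrank _ _ (hl v j)).trans (y.line v j).2⟩⟩
  have hpt : ∀ v i, (y₁.pt v i).submodule = (y.pt v i).submodule.map (1 + s • Mp v i) :=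
    fun v i => Projectivization.submodule_mk'' _ _
  refine ⟨y₁, ⟨⟨?_, ?_⟩, _, ⟨?_, ?_⟩, hs⟩, hpt, fun v j => rfl⟩
  · intro v i j hij
    rw [hpt]
    rintro _ ⟨x, hx, rfl⟩
    refine ⟨x, hy v i j hij hx, ?_⟩
    simp [hinc v i j hij x hx]
  · rw [← hyK]
    ext v i : 3
    · apply Projectivization.submodule_injective
      refine (hpt v ⟨i.1.1, i.2⟩).trans ?_
      rw [hkp v i.1.1 i.1.2, smul_zero, add_zero]
      exact Submodule.map_id _
    · refine Subtype.ext ?_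
      change (y.line v ⟨i.1.1, i.2⟩).1.map (1 + s • Ml v i.1.1) = (y.line v ⟨i.1.1, i.2⟩).1
      refine Submodule.eq_of_le_of_finrank_eq ?_ (hrank _ _ (hl v i.1.1))
      rintro _ ⟨x, hx, rfl⟩
      exact add_mem hx (Submodule.smul_mem _ _ (hkl v ⟨i.1.1, i.2⟩ i.1.2 ⟨x, hx, rfl⟩))
  · intro v i
    rw [hpt, hd.1, Submodule.map_span, Set.image_singleton]
    rfl
  · intro v j
    change (y.line v j).1.map (1 + s • Ml v j) = _
    rw [hd.2, Submodule.map_span, ← Set.range_comp]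
    rfl

theorem exists_dual_ne_zero {p : Fin 3 → 𝕜} (hp : p ≠ 0) : ∃ φ : Dual 𝕜 (Fin 3 → 𝕜), φ p ≠ 0 := by
  by_contra! h
  exact hp ((forall_dual_apply_eq_zero_iff 𝕜 p).1 h)

section
variable [Infinite 𝕜] {U : Set (JointImage 𝕜 Q)}

open Classical in
-- Only the line `j` in view `v` is moved, by `x ↦ x + s φ(x) u`. Since `φ` vanishes on the observed
-- points of the line, these stay incident to it without being moved.
theorem Movable.exists_line (hU : Movable K U) {y : JointImage 𝕜 Q} (hy : y ∈ U) {v : Fin 3}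
    (j : Q.lineObs v) (hj : (j : κ) ∉ K.lines) (φ : Dual 𝕜 (Fin 3 → 𝕜)) (u : Fin 3 → 𝕜)
    (hφ : ∀ i : Q.ptObs v, Q.inc i j → ∀ x ∈ (y.pt v i).submodule, φ x = 0) :
    ∃ s : 𝕜, s ≠ 0 ∧ ∃ y₁ ∈ U, y₁.pt = y.pt ∧
      (∀ v' (j' : Q.lineObs v'), (v', (j' : κ)) ≠ (v, (j : κ)) → y₁.line v' j' = y.line v' j') ∧
      (y₁.line v j).1 = (y.line v j).1.map (1 + s • φ.smulRight u) := by
  have h := hU y hy 0 (fun v' j' => if (v', j') = (v, (j : κ)) then φ.smulRight u else 0) ?_ ?_ ?_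
  · obtain ⟨s, ⟨y₁, hy₁, hp, hl⟩, hs⟩ := (h.and (eventually_cofinite_ne (0 : 𝕜))).exists
    refine ⟨s, hs, y₁, hy₁, ?_, fun v' j' hne => ?_, ?_⟩
    · ext v' i' : 2
      apply Projectivization.submodule_injective
      rw [hp]
      simp only [Pi.zero_apply, smul_zero, add_zero]
      exact Submodule.map_id _
    · refine Subtype.ext ?_
      rw [hl, if_neg hne, smul_zero, add_zero]
      exact Submodule.map_id _
    · rw [hl, if_pos rfl]
  · intro v' i' j' hij x hx
    split_ifs with he
    · obtain ⟨rfl, he⟩ := Prod.ext_iff.1 he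
      obtain rfl : j' = j := Subtype.ext he
      simp [hφ i' hij x hx]
    · rfl
  · exact fun _ _ _ => rfl
  · intro v' j' hj'
    rw [if_neg]
    · rw [Submodule.map_zero]; exact bot_le
    · intro he
      exact hj ((show (j' : κ) = j from (Prod.ext_iff.1 he).2) ▸ hj')

/-- With no observed point on the line, `φ` is unrestricted and can be chosen with `φ q ≠ 0`, and
`u` off the line. If `q = x + s φ(x) u` with `x` and `q` on the old line, then either `φ x = 0`, so
`q = x` and `φ q = 0`, or `u` lies on the line. -/
theorem Movable.exists_line_notMem (hU : Movable K U) {y : JointImage 𝕜 Q} (hy : y ∈ U)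
    {v : Fin 3} (j : Q.lineObs v) (hj : (j : κ) ∉ K.lines) (hinc : ∀ i ∈ Q.ptObs v, ¬ Q.inc i j)
    {q : Fin 3 → 𝕜} (hq : q ≠ 0) :
    ∃ y₁ ∈ U, y₁.pt = y.pt ∧
      (∀ v' (j' : Q.lineObs v'), (v', (j' : κ)) ≠ (v, (j : κ)) → y₁.line v' j' = y.line v' j') ∧
      q ∉ (y₁.line v j).1 := by
  by_cases hql : q ∈ (y.line v j).1
  · obtain ⟨φ, hφ⟩ := exists_dual_ne_zero hq
    obtain ⟨u, -, hu⟩ := exists_mem_notMem_of_finrank_lt (𝕜 := 𝕜)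
      (L := (⊤ : Submodule 𝕜 (Fin 3 → 𝕜))) (M := (y.line v j).1)
      (by rw [(y.line v j).2, finrank_top]; simp)
    obtain ⟨s, hs, y₁, hy₁, h1, h2, h3⟩ := hU.exists_line hy j hj φ u
      fun i hi => absurd hi (hinc i i.2)
    refine ⟨y₁, hy₁, h1, h2, ?_⟩
    rw [h3]
    rintro ⟨x, hx, hxq⟩
    have hxq' : x + s • φ x • u = q := hxq
    by_cases hφx : φ x = 0
    · rw [hφx, zero_smul, smul_zero, add_zero] at hxq'
      exact hφ (hxq' ▸ hφx)
    · have : (s * φ x) • u ∈ (y.line v j).1 := by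
        rw [mul_smul, ← add_sub_cancel_left x (s • φ x • u), hxq']
        exact sub_mem hql hx
      exact hu (((y.line v j).1.smul_mem_iff (mul_ne_zero hs hφx)).1 this)
  · exact ⟨y, hy, rfl, fun _ _ _ => rfl, hql⟩

/-- Here the line may carry an observed point, so it can only be rotated about it: `φ` vanishes on
that point but not on another point `z` of the line, and `z` is pushed off the line. -/
theorem Movable.exists_line_ne (hU : Movable K U) {y : JointImage 𝕜 Q} (hy : y ∈ U)
    {v : Fin 3} (j : Q.lineObs v) (hj : (j : κ) ∉ K.lines) (T : Submodule 𝕜 (Fin 3 → 𝕜)) :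
    ∃ y₁ ∈ U, y₁.pt = y.pt ∧
      (∀ v' (j' : Q.lineObs v'), (v', (j' : κ)) ≠ (v, (j : κ)) → y₁.line v' j' = y.line v' j') ∧
      (y₁.line v j).1 ≠ T := by
  by_cases hT : (y.line v j).1 = T
  · obtain ⟨W, hW, hWp⟩ : ∃ W : Submodule 𝕜 (Fin 3 → 𝕜), finrank 𝕜 W ≤ 1 ∧
        ∀ i : Q.ptObs v, Q.inc i j → (y.pt v i).submodule ≤ W := by
      by_cases hi : ∃ i : Q.ptObs v, Q.inc i j
      · obtain ⟨i, hi⟩ := hi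
        refine ⟨_, (y.pt v i).finrank_submodule.le, fun i' hi' => ?_⟩
        rw [Subtype.ext (Q.inc_unique i' i j hi' hi)]
      · exact ⟨⊥, by simp, fun i hi' => absurd ⟨i, hi'⟩ hi⟩
    obtain ⟨z, hz, hzW⟩ := exists_mem_notMem_of_finrank_lt (𝕜 := 𝕜) (L := (y.line v j).1) (M := W)
      (by rw [(y.line v j).2]; omega)
    obtain ⟨φ, hφ, hφW⟩ := Submodule.exists_le_ker_of_notMem hzW
    obtain ⟨u, -, hu⟩ := exists_mem_notMem_of_finrank_lt (𝕜 := 𝕜)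
      (L := (⊤ : Submodule 𝕜 (Fin 3 → 𝕜))) (M := (y.line v j).1)
      (by rw [(y.line v j).2, finrank_top]; simp)
    obtain ⟨s, hs, y₁, hy₁, h1, h2, h3⟩ := hU.exists_line hy j hj φ u
      fun i hi x hx => hφW (hWp i hi hx)
    refine ⟨y₁, hy₁, h1, h2, fun hc => ?_⟩
    have hzm : z + s • φ z • u ∈ (y.line v j).1 := by
      rw [hT, ← hc, h3]
      exact ⟨z, hz, rfl⟩
    have : (s * φ z) • u ∈ (y.line v j).1 := by
      rw [mul_smul, ← add_sub_cancel_left z (s • φ z • u)]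
      exact sub_mem hzm hz
    exact hu (((y.line v j).1.smul_mem_iff (mul_ne_zero hs hφ)).1 this)
  · exact ⟨y, hy, rfl, fun _ _ _ => rfl, hT⟩

open Classical in
-- The point and all its pins in view `v` are moved by the same map `1 + s φ ⊗ u`. A kept pin is
-- preserved as a whole because `u` lies on its image.
theorem Movable.exists_point_not_le (hU : Movable K U) {y : JointImage 𝕜 Q} (hy : y ∈ U)
    {v : Fin 3} (i : Q.ptObs v) (hi : (i : ι) ∉ K.pts) {T : Submodule 𝕜 (Fin 3 → 𝕜)}
    {u : Fin 3 → 𝕜} (hu : u ∉ T)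
    (hul : ∀ j : Q.lineObs v, (j : κ) ∈ K.lines → Q.inc i j → u ∈ (y.line v j).1) :
    ∃ y₁ ∈ U, (∀ v', v' ≠ v → ∀ i', y₁.pt v' i' = y.pt v' i') ∧
      ¬ (y₁.pt v i).submodule ≤ T := by
  by_cases hT : (y.pt v i).submodule ≤ T
  · obtain ⟨φ, hφ⟩ := exists_dual_ne_zero (y.pt v i).rep_nonzero
    have hrep : (y.pt v i).rep ∈ (y.pt v i).submodule := by
      rw [Projectivization.submodule_eq]
      exact Submodule.mem_span_singleton_self _
    have h := hU y hy (fun v' i' => if (v', i') = (v, (i : ι)) then φ.smulRight u else 0)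
      (fun v' j' => if v' = v ∧ Q.inc i j' then φ.smulRight u else 0) ?_ ?_ ?_
    · obtain ⟨s, ⟨y₁, hy₁, hp, hl⟩, hs⟩ := (h.and (eventually_cofinite_ne (0 : 𝕜))).exists
      refine ⟨y₁, hy₁, fun v' hv' i' => ?_, fun hc => ?_⟩
      · apply Projectivization.submodule_injective
        rw [hp, if_neg (fun he => hv' (Prod.ext_iff.1 he).1), smul_zero, add_zero]
        exact Submodule.map_id _
      · rw [hp, if_pos rfl] at hc
        have h1 : (y.pt v i).rep + s • φ (y.pt v i).rep • u ∈ T := hc ⟨_, hrep, rfl⟩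
        have h2 := sub_mem h1 (hT hrep)
        rw [add_sub_cancel_left, ← mul_smul] at h2
        exact hu ((T.smul_mem_iff (mul_ne_zero hs hφ)).1 h2)
    · intro v' i' j' hij x hx
      have : (v', (i' : ι)) = (v, (i : ι)) ↔ v' = v ∧ Q.inc i j' := by
        rw [Prod.mk_inj]
        exact and_congr_right fun _ =>
          ⟨fun h => h ▸ hij, fun h => Q.inc_unique _ _ _ hij h⟩
      simp only [this]
    · intro v' i' hi'
      rw [if_neg]
      exact fun he => hi ((show i' = i from (Prod.ext_iff.1 he).2) ▸ hi')
    · intro v' j' hj'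
      split_ifs with he
      · obtain ⟨rfl, he⟩ := he
        rintro _ ⟨x, -, rfl⟩
        exact Submodule.smul_mem _ _ (hul j' hj' he)
      · rw [Submodule.map_zero]; exact bot_le
  · exact ⟨y, hy, fun _ _ _ => rfl, hT⟩

end

/-! ### Necessary conditions for reducibility -/

/-- All joint images in the movable nonempty set `U` have solutions that agree with `S₀` on the
kept features and on the cameras. -/
structure LiftsNear (K : Kept ι κ) (S₀ : Scene 𝕜 ι κ) (U : Set (JointImage 𝕜 Q)) : Prop where
  nonempty : U.Nonempty
  movable : Movable K U
  cam_mem : S₀.cam ∈ cameras 𝕜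
  lift : ∀ y ∈ U, ∃ S ∈ Q.sceneVariety 𝕜, Q.Projects S y ∧ S.cam = S₀.cam ∧
    (∀ i ∈ K.pts, S.pt i = S₀.pt i) ∧ ∀ j ∈ K.lines, S.line j = S₀.line j

/-- One generic `S'` and the generic part `U` of the fibre over its image suffice. `S₀` is any one
lift; it represents the kept features and cameras, which all lifts share, as a scene of `Q` itself.
-/
theorem IsReducibleTo.exists_liftsNear [Finite ι] [Finite κ] (h : Q.IsReducibleTo 𝕜 K) :
    ∃ (S₀ : Scene 𝕜 ι κ) (U : Set (JointImage 𝕜 Q)), LiftsNear K S₀ U := by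
  obtain ⟨-, F, ⟨S', hS', c, hc, hF⟩, hall⟩ := h
  obtain ⟨y', -, G, ⟨y, hy, d, hd, hG⟩, hlift⟩ := hall S' hS' c hc hF
  let U : Set (JointImage 𝕜 Q) := {y | (y ∈ Q.imageVariety 𝕜 ∧ Q.forgetImage K y = y') ∧
    ∃ d, y.HasCoords d ∧ MvPolynomial.eval d G ≠ 0}
  have hl : ∀ y ∈ U, ∃ S ∈ Q.sceneVariety 𝕜, Q.Projects S y ∧ forgetScene K S = S' := by
    rintro y ⟨hy, d, hd, hG⟩
    exact hlift y hy d hd hG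
  obtain ⟨S₀, hS₀, -, h0⟩ := hl y ⟨hy, d, hd, hG⟩
  refine ⟨S₀, U, ⟨⟨y, hy, d, hd, hG⟩, movable_fiber y' G, hS₀.2, fun y hy => ?_⟩⟩
  obtain ⟨S, hS, hp, h1⟩ := hl y hy
  have h2 : forgetScene K S = forgetScene K S₀ := h1.trans h0.symm
  exact ⟨S, hS, hp, congrArg (fun T => T.cam) h2,
    fun i hi => congrFun (congrArg (fun T => T.pt) h2) ⟨i, hi⟩,
    fun j hj => congrFun (congrArg (fun T => T.line) h2) ⟨j, hj⟩⟩

theorem Projects.eq_zero_of_mem_line {S : Scene 𝕜 ι κ} {y : JointImage 𝕜 Q} (h : Q.Projects S y)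
    {v : Fin 3} {j : κ} (hj : j ∈ Q.lineObs v) {x : Fin 4 → 𝕜} (hx : x ∈ (S.line j).1)
    (hx0 : (S.cam v).mulVecLin x = 0) : x = 0 :=
  eq_zero_of_finrank_map_eq (f := (S.cam v).mulVecLin) (L := (S.line j).1)
    (by rw [h.2 v ⟨j, hj⟩, (y.line v _).2, (S.line j).2]) hx hx0

theorem rep_mem_submodule {n : ℕ} (p : Projectivization 𝕜 (Fin n → 𝕜)) : p.rep ∈ p.submodule := by
  rw [Projectivization.submodule_eq]
  exact Submodule.mem_span_singleton_self _

theorem Projects.apply_mem_line {S : Scene 𝕜 ι κ} {y : JointImage 𝕜 Q} (h : Q.Projects S y)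
    {v : Fin 3} (j : Q.lineObs v) {x : Fin 4 → 𝕜} (hx : x ∈ (S.line j).1) :
    (S.cam v).mulVecLin x ∈ (y.line v j).1 := by
  rw [← h.2 v j]
  exact ⟨x, hx, rfl⟩

theorem Projects.apply_mem_pt {S : Scene 𝕜 ι κ} {y : JointImage 𝕜 Q} (h : Q.Projects S y)
    {v : Fin 3} (i : Q.ptObs v) {x : Fin 4 → 𝕜} (hx : x ∈ (S.pt i).submodule) :
    (S.cam v).mulVecLin x ∈ (y.pt v i).submodule := by
  rw [← h.1 v i]
  exact ⟨x, hx, rfl⟩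

/-- A point on a given observed line is determined by one of its images. -/
theorem Projects.pt_eq_of_pin {i : ι} {j : κ} (hij : Q.inc i j) {v : Fin 3}
    (hv : i ∈ Q.ptObs v) (hjv : j ∈ Q.lineObs v) {y₁ y₂ : JointImage 𝕜 Q} {S₁ S₂ : Scene 𝕜 ι κ} (hS₁ : S₁ ∈ Q.sceneVariety 𝕜)
    (hS₂ : S₂ ∈ Q.sceneVariety 𝕜) (hp₁ : Q.Projects S₁ y₁) (hp₂ : Q.Projects S₂ y₂)
    (hcam : S₂.cam = S₁.cam) (hl : S₂.line j = S₁.line j)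
    (hy : y₂.pt v ⟨i, hv⟩ = y₁.pt v ⟨i, hv⟩) : S₂.pt i = S₁.pt i := by
  apply Projectivization.submodule_injective
  refine Submodule.eq_of_le_of_finrank_eq ?_ (by simp only [Projectivization.finrank_submodule])
  intro x hx
  have h1 : (S₁.cam v).mulVecLin x ∈ (S₁.pt i).submodule.map (S₁.cam v).mulVecLin := by
    rw [hp₁.1 v ⟨i, hv⟩, ← hy, ← hcam]
    exact hp₂.apply_mem_pt ⟨i, hv⟩ hx
  obtain ⟨x', hx', he⟩ := h1
  have h2 : x - x' ∈ (S₁.line j).1 := sub_mem (hl ▸ hS₂.1 i j hij hx) (hS₁.1 i j hij hx')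
  have h3 := hp₁.eq_zero_of_mem_line hjv h2 (by rw [map_sub, he, sub_self])
  rwa [sub_eq_zero.1 h3]

variable [Infinite 𝕜] {S₀ : Scene 𝕜 ι κ} {U : Set (JointImage 𝕜 Q)}

/-- Three back-projected planes have no line in common in general. Moving the image in view 1 makes
the planes of views 0 and 1 distinct, so the lifted line must be their intersection; moving the
image in view 2 off the projection of that intersection leaves no lift. -/
theorem LiftsNear.exists_notMem_lineObs (h : LiftsNear K S₀ U) {j : κ} (hj : j ∉ K.lines) :
    ∃ v, j ∉ Q.lineObs v := by
  by_contra! hall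
  obtain ⟨y, hy⟩ := h.nonempty
  let f := fun v => (S₀.cam v).mulVecLin
  have hf : ∀ v, Function.Surjective (f v) := mulVecLin_surjective h.cam_mem
  obtain ⟨y₁, hy₁, -, hl₁, hne₁⟩ := h.movable.exists_line_ne hy ⟨j, hall 1⟩ hj
    (((y.line 0 ⟨j, hall 0⟩).1.comap (f 0)).map (f 1))
  rw [← hl₁ 0 ⟨j, hall 0⟩ (by simp)] at hne₁
  set W := (y₁.line 0 ⟨j, hall 0⟩).1.comap (f 0) with hW
  set W₁ := (y₁.line 1 ⟨j, hall 1⟩).1.comap (f 1) with hW₁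
  obtain ⟨y₂, hy₂, -, hl₂, hne₂⟩ := h.movable.exists_line_ne hy₁ ⟨j, hall 2⟩ hj
    ((W ⊓ W₁).map (f 2))
  obtain ⟨S, -, hp, hcam, -⟩ := h.lift y₂ hy₂
  have hrW : finrank 𝕜 W = 3 := by
    rw [finrank_comap_of_surjective (hf 0), finrank_ker_of_surjective (hf 0), (y₁.line 0 _).2]
  have hWW : ¬ W ≤ W₁ := by
    intro hle
    rw [hW₁, ← Submodule.map_le_iff_le_comap] at hle
    refine hne₁ (Submodule.eq_of_le_of_finrank_le hle ?_).symm
    have h1 := finrank_map_add_finrank_inf_ker (f 1) W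
    have h2 := Submodule.finrank_mono (inf_le_right : W ⊓ LinearMap.ker (f 1) ≤ _)
    rw [finrank_ker_of_surjective (hf 1)] at h2
    rw [(y₁.line 1 _).2]
    omega
  have hlt : finrank 𝕜 (W ⊓ W₁ : Submodule 𝕜 (Fin 4 → 𝕜)) < 3 := by
    rw [← hrW]
    exact Submodule.finrank_lt_finrank_of_lt (inf_lt_left.2 hWW)
  have hle : (S.line j).1 ≤ W ⊓ W₁ := by
    rw [le_inf_iff, hW, hW₁, ← Submodule.map_le_iff_le_comap, ← Submodule.map_le_iff_le_comap,
      ← hl₂ 0 ⟨j, hall 0⟩ (by simp), ← hl₂ 1 ⟨j, hall 1⟩ (by simp), ← hp.2, ← hp.2, hcam]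
    exact ⟨le_rfl, le_rfl⟩
  have heq := Submodule.eq_of_le_of_finrank_le hle (by rw [(S.line j).2]; omega)
  exact hne₂ (by rw [← heq, ← hp.2, hcam])

/-- The kept point is fixed in space, so its projection to `v` is fixed. If `v` does not observe it,
the image of the pin can be moved off this projection. -/
theorem LiftsNear.mem_ptObs_of_pin (h : LiftsNear K S₀ U) {i : ι} (hi : i ∈ K.pts) {j : κ}
    (hj : j ∉ K.lines) (hij : Q.inc i j) {v : Fin 3} (hv : j ∈ Q.lineObs v) : i ∈ Q.ptObs v := by
  by_contra hiv
  obtain ⟨y, hy⟩ := h.nonempty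
  obtain ⟨S, hS, hp, hcam, hpt, -⟩ := h.lift y hy
  have hx : (S.pt i).rep ∈ (S.line j).1 := hS.1 i j hij (rep_mem_submodule _)
  obtain ⟨y₁, hy₁, -, -, hq⟩ := h.movable.exists_line_notMem hy ⟨j, hv⟩ hj
    (fun i' hi' hc => hiv (Q.inc_unique i' i j hc hij ▸ hi'))
    (q := (S.cam v).mulVecLin (S.pt i).rep)
    (fun h0 => (S.pt i).rep_nonzero (hp.eq_zero_of_mem_line hv hx h0))
  obtain ⟨S₁, hS₁, hp₁, hcam₁, hpt₁, -⟩ := h.lift y₁ hy₁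
  refine hq ?_
  rw [hcam, ← hcam₁, hpt i hi, ← hpt₁ i hi]
  exact hp₁.apply_mem_line ⟨j, hv⟩ (hS₁.1 i j hij (rep_mem_submodule _))

/-- A forgotten point without kept pins is observed in at most one view. -/
theorem LiftsNear.eq_of_mem_ptObs (h : LiftsNear K S₀ U) {i : ι} (hi : i ∉ K.pts)
    (hpins : ∀ j ∈ K.lines, ¬ Q.inc i j) {v w : Fin 3} (hv : i ∈ Q.ptObs v)
    (hw : i ∈ Q.ptObs w) : v = w := by
  by_contra hne
  obtain ⟨y, hy⟩ := h.nonempty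
  let f := fun v => (S₀.cam v).mulVecLin
  have hf : ∀ v, Function.Surjective (f v) := mulVecLin_surjective h.cam_mem
  -- `T` is the image in `w` of the ray seen from `v`. It must contain the image of the point in
  -- `w`, which can be moved off it.
  set T := ((y.pt v ⟨i, hv⟩).submodule.comap (f v)).map (f w) with hT
  have hrT : finrank 𝕜 T ≤ 2 := by
    refine (Submodule.finrank_map_le _ _).trans ?_
    rw [finrank_comap_of_surjective (hf v), finrank_ker_of_surjective (hf v),
      Projectivization.finrank_submodule]
  obtain ⟨u, -, hu⟩ := exists_mem_notMem_of_finrank_lt (𝕜 := 𝕜)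
    (L := (⊤ : Submodule 𝕜 (Fin 3 → 𝕜))) (M := T) (by rw [finrank_top]; simp; omega)
  obtain ⟨y₁, hy₁, hp, hle⟩ := h.movable.exists_point_not_le hy ⟨i, hw⟩ hi hu
    fun j hj hij => absurd hij (hpins j hj)
  obtain ⟨S, hS, hproj, hcam, -⟩ := h.lift y₁ hy₁
  apply hle
  rw [← hproj.1 w ⟨i, hw⟩, hT, hcam]
  refine Submodule.map_mono ?_
  rw [← Submodule.map_le_iff_le_comap, ← hp v hne, ← hproj.1 v ⟨i, hv⟩, hcam]

/-- For a forgotten point without kept pins that is observed in a view, the pins are not observed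
in both of the other views. -/
theorem LiftsNear.not_pins_observed (h : LiftsNear K S₀ U) {i : ι}
    (hpins : ∀ j ∈ K.lines, ¬ Q.inc i j) {v w w' : Fin 3} (hv : i ∈ Q.ptObs v) (hww : w ≠ w')
    (hw : i ∉ Q.ptObs w) (hw' : i ∉ Q.ptObs w') {j j' : κ} (hij : Q.inc i j) (hij' : Q.inc i j')
    (hj : j ∈ Q.lineObs w) (hj' : j' ∈ Q.lineObs w') : False := by
  have hinc : ∀ {w j}, i ∉ Q.ptObs w → Q.inc i j → ∀ i' ∈ Q.ptObs w, ¬ Q.inc i' j :=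
    fun hw hij i' hi' hc => hw (Q.inc_unique i' i _ hc hij ▸ hi')
  obtain ⟨y, hy⟩ := h.nonempty
  let f := fun v => (S₀.cam v).mulVecLin
  have hf : ∀ v, Function.Surjective (f v) := mulVecLin_surjective h.cam_mem
  have hray : ∀ y : JointImage 𝕜 Q,
      finrank 𝕜 ((y.pt v ⟨i, hv⟩).submodule.comap (f v)) = 2 := fun y => by
    rw [finrank_comap_of_surjective (hf v), finrank_ker_of_surjective (hf v),
      Projectivization.finrank_submodule]
  -- A point `r` of the ray other than the centre of camera `w`. Moving the image of `j` off `f w r`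
  -- makes its back-projected plane cut the ray in at most one point, which determines point `i`.
  obtain ⟨r, hr, hr0⟩ := exists_mem_notMem_of_finrank_lt (𝕜 := 𝕜)
    (L := (y.pt v ⟨i, hv⟩).submodule.comap (f v)) (M := LinearMap.ker (f w))
    (by rw [hray, finrank_ker_of_surjective (hf w)]; omega)
  obtain ⟨y₁, hy₁, hpt₁, -, hq⟩ := h.movable.exists_line_notMem hy ⟨j, hj⟩
    (fun hc => hpins j hc hij) (hinc hw hij) (q := f w r) hr0
  rw [← hpt₁] at hr
  set W := (y₁.pt v ⟨i, hv⟩).submodule.comap (f v) ⊓ (y₁.line w ⟨j, hj⟩).1.comap (f w) with hW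
  have hrW : finrank 𝕜 W ≤ 1 := by
    have : W < (y₁.pt v ⟨i, hv⟩).submodule.comap (f v) :=
      inf_lt_left.2 fun hle => hq (hle hr)
    have := Submodule.finrank_lt_finrank_of_lt this
    rw [hray] at this
    omega
  have hmem : ∀ y : JointImage 𝕜 Q, ∀ S ∈ Q.sceneVariety 𝕜, Q.Projects S y → S.cam = S₀.cam →
      y.pt v ⟨i, hv⟩ = y₁.pt v ⟨i, hv⟩ → y.line w ⟨j, hj⟩ = y₁.line w ⟨j, hj⟩ →
      (S.pt i).rep ∈ W := by
    intro y S hS hp hcam h1 h2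
    rw [hW, ← h1, ← h2]
    constructor
    · have := hp.apply_mem_pt ⟨i, hv⟩ (rep_mem_submodule (S.pt i))
      rwa [hcam] at this
    · have := hp.apply_mem_line ⟨j, hj⟩ (hS.1 i j hij (rep_mem_submodule (S.pt i)))
      rwa [hcam] at this
  obtain ⟨S, hS, hp, hcam, -⟩ := h.lift y₁ hy₁
  have hspan := eq_span_singleton_of_finrank_le_one hrW (hmem y₁ S hS hp hcam rfl rfl)
    (S.pt i).rep_nonzero
  -- The image of `j'` in the remaining view is moved off the projection of the point already
  -- determined.
  obtain ⟨y₂, hy₂, hpt₂, hl₂, hq₂⟩ := h.movable.exists_line_notMem hy₁ ⟨j', hj'⟩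
    (fun hc => hpins j' hc hij') (hinc hw' hij') (q := f w' (S.pt i).rep) (fun h0 =>
      (S.pt i).rep_nonzero (hp.eq_zero_of_mem_line hj'
        (hS.1 i j' hij' (rep_mem_submodule _)) (by rw [hcam]; exact h0)))
  obtain ⟨S₂, hS₂, hp₂, hcam₂, -⟩ := h.lift y₂ hy₂
  have hm := hmem y₂ S₂ hS₂ hp₂ hcam₂ (by rw [hpt₂])
    (hl₂ _ _ fun he => hww (Prod.ext_iff.1 he).1)
  rw [hspan, Submodule.mem_span_singleton] at hm
  obtain ⟨a, ha⟩ := hm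
  have ha0 : a ≠ 0 := fun h0 => (S₂.pt i).rep_nonzero (by rw [← ha, h0, zero_smul])
  have := hp₂.apply_mem_line ⟨j', hj'⟩ (hS₂.1 i j' hij' (rep_mem_submodule (S₂.pt i)))
  rw [← ha, map_smul, hcam₂] at this
  exact hq₂ (((y₂.line w' ⟨j', hj'⟩).1.smul_mem_iff ha0).1 this)

/-- A kept pin of a forgotten point is observed wherever the point is. -/
theorem LiftsNear.mem_lineObs_of_pin (h : LiftsNear K S₀ U) {i : ι} (hi : i ∉ K.pts) {j : κ}
    (hj : j ∈ K.lines) (hij : Q.inc i j)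
    (huniq : ∀ j' ∈ K.lines, Q.inc i j' → j' = j) {v : Fin 3} (hv : i ∈ Q.ptObs v) :
    j ∈ Q.lineObs v := by
  by_contra hjv
  obtain ⟨y, hy⟩ := h.nonempty
  -- `T` is the projection of the kept pin. As `v` does not see the pin, no kept line confines the
  -- image of the point, which can be moved off `T`.
  set T := (S₀.line j).1.map (S₀.cam v).mulVecLin with hT
  have hrT : finrank 𝕜 T ≤ 2 := (Submodule.finrank_map_le _ _).trans (S₀.line j).2.le
  obtain ⟨u, -, hu⟩ := exists_mem_notMem_of_finrank_lt (𝕜 := 𝕜)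
    (L := (⊤ : Submodule 𝕜 (Fin 3 → 𝕜))) (M := T) (by rw [finrank_top]; simp; omega)
  obtain ⟨y₁, hy₁, -, hle⟩ := h.movable.exists_point_not_le hy ⟨i, hv⟩ hi hu
    fun j' hj' hij' => absurd (huniq j' hj' hij' ▸ j'.2) hjv
  obtain ⟨S, hS, hproj, hcam, -, hl⟩ := h.lift y₁ hy₁
  apply hle
  rw [← hproj.1 v ⟨i, hv⟩, hT, hcam, ← hl j hj]
  exact Submodule.map_mono (hS.1 i j hij)

/-- A forgotten point with a kept pin is observed in at most one view. -/
theorem LiftsNear.eq_of_mem_ptObs_of_pin (h : LiftsNear K S₀ U) {i : ι} (hi : i ∉ K.pts) {j : κ}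
    (hj : j ∈ K.lines) (hij : Q.inc i j)
    (huniq : ∀ j' ∈ K.lines, Q.inc i j' → j' = j) {v w : Fin 3} (hv : i ∈ Q.ptObs v)
    (hw : i ∈ Q.ptObs w) : v = w := by
  by_contra hne
  have hjv := h.mem_lineObs_of_pin hi hj hij huniq hv
  have hjw := h.mem_lineObs_of_pin hi hj hij huniq hw
  obtain ⟨y, hy⟩ := h.nonempty
  obtain ⟨S, hS, hp, hcam, -, hl⟩ := h.lift y hy
  -- The image in `w` slides along the kept pin towards `u`. The image in `v` is unchanged and fixes
  -- the point on the pin, so no lift matches both.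
  obtain ⟨u, hu, hu'⟩ := exists_mem_notMem_of_finrank_lt (𝕜 := 𝕜)
    (L := (y.line w ⟨j, hjw⟩).1) (M := (y.pt w ⟨i, hw⟩).submodule)
    (by rw [(y.line w _).2, Projectivization.finrank_submodule]; omega)
  obtain ⟨y₁, hy₁, hpt₁, hle⟩ := h.movable.exists_point_not_le hy ⟨i, hw⟩ hi hu'
    fun j' hj' hij' => by
      obtain rfl : j' = ⟨j, hjw⟩ := Subtype.ext (huniq j' hj' hij')
      exact hu
  obtain ⟨S₁, hS₁, hp₁, hcam₁, -, hl₁⟩ := h.lift y₁ hy₁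
  have he := hp.pt_eq_of_pin hij hv hjv hS hS₁ hp₁ (hcam₁.trans hcam.symm)
    ((hl₁ j hj).trans (hl j hj).symm) (hpt₁ v hne _)
  apply hle
  rw [← hp₁.1 w ⟨i, hw⟩, ← hp.1 w ⟨i, hw⟩, he, hcam, hcam₁]

/-- If a forgotten point with a kept pin is observed, then its other pins are observed only where
the point is. -/
theorem LiftsNear.mem_ptObs_of_other_pin (h : LiftsNear K S₀ U) {i : ι} (hi : i ∉ K.pts) {j j' : κ}
    (hj : j ∈ K.lines) (hij : Q.inc i j) (hij' : Q.inc i j') (hne : j' ≠ j)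
    (huniq : ∀ j' ∈ K.lines, Q.inc i j' → j' = j) {v w : Fin 3} (hv : i ∈ Q.ptObs v)
    (hw : j' ∈ Q.lineObs w) : i ∈ Q.ptObs w := by
  by_contra hiw
  have hjv := h.mem_lineObs_of_pin hi hj hij huniq hv
  obtain ⟨y, hy⟩ := h.nonempty
  obtain ⟨S, hS, hp, hcam, -, hl⟩ := h.lift y hy
  have hx : (S.pt i).rep ∈ (S.line j').1 := hS.1 i j' hij' (rep_mem_submodule _)
  obtain ⟨y₁, hy₁, hpt₁, -, hq⟩ := h.movable.exists_line_notMem hy ⟨j', hw⟩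
    (fun hc => hne (huniq j' hc hij'))
    (fun i' hi' hc => hiw (Q.inc_unique i' i j' hc hij' ▸ hi'))
    (q := (S.cam w).mulVecLin (S.pt i).rep)
    (fun h0 => (S.pt i).rep_nonzero (hp.eq_zero_of_mem_line hw hx h0))
  obtain ⟨S₁, hS₁, hp₁, hcam₁, -, hl₁⟩ := h.lift y₁ hy₁
  have he := hp.pt_eq_of_pin hij hv hjv hS hS₁ hp₁ (hcam₁.trans hcam.symm)
    ((hl₁ j hj).trans (hl j hj).symm) (by rw [hpt₁])
  refine hq ?_
  rw [← he, hcam, ← hcam₁]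
  exact hp₁.apply_mem_line ⟨j', hw⟩ (hS₁.1 i j' hij' (rep_mem_submodule _))

theorem IsReducibleTo.core_subset [Finite ι] [Finite κ] (h : Q.IsReducibleTo 𝕜 K) :
    Q.core.pts ⊆ K.pts ∧ Q.core.lines ⊆ K.lines := by
  obtain ⟨S₀, U, hU⟩ := h.exists_liftsNear
  have hp : Q.core.pts ⊆ K.pts := by
    intro i hic
    by_contra hi
    obtain ⟨v, hv, hc⟩ := mem_core_pts.1 hic
    by_cases hpins : ∃ j ∈ K.lines, Q.inc i j
    · obtain ⟨j, hj, hij⟩ := hpins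
      have huniq : ∀ j' ∈ K.lines, Q.inc i j' → j' = j := fun j' hj' hij' =>
        h.1 i hi j' hj' j hj hij' hij
      obtain ⟨w, hwv, hw⟩ | ⟨h1, h2⟩ := hc
      · exact hwv (hU.eq_of_mem_ptObs_of_pin hi hj hij huniq hw hv)
      -- Some view `u` misses the kept pin, and `u ≠ v` because the pin is seen wherever the point
      -- is. Another pin is seen in `u`, which forces the point to be observed there: a second view.
      · obtain ⟨u, hu⟩ := h2 j hij
        have huv : u ≠ v := by
          rintro rfl
          exact hu (hU.mem_lineObs_of_pin hi hj hij huniq hv)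
        obtain ⟨j', hij', hj'⟩ := h1 u huv
        have hne : j' ≠ j := by rintro rfl; exact hu hj'
        exact huv (hU.eq_of_mem_ptObs_of_pin hi hj hij huniq
          (hU.mem_ptObs_of_other_pin hi hj hij hij' hne huniq hv hj') hv)
    · push Not at hpins
      have hview : ∀ w, w ≠ v → i ∉ Q.ptObs w := fun w hw hiw =>
        hw (hU.eq_of_mem_ptObs hi hpins hiw hv)
      obtain ⟨w, hwv, hw⟩ | ⟨h1, -⟩ := hc
      · exact hview w hwv hw
      · obtain ⟨w, w', hw, hw', hww⟩ : ∃ w w', w ≠ v ∧ w' ≠ v ∧ w ≠ w' := by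
          clear * -
          revert v; decide
        obtain ⟨j, hij, hj⟩ := h1 w hw
        obtain ⟨j', hij', hj'⟩ := h1 w' hw'
        exact hU.not_pins_observed hpins hv hww (hview w hw) (hview w' hw') hij hij' hj hj'
  refine ⟨hp, fun j hjc => ?_⟩
  by_contra hj
  obtain hf | ⟨i, hi, hij, v, hv, hiv⟩ := mem_core_lines.1 hjc
  · obtain ⟨v, hv⟩ := hU.exists_notMem_lineObs hj
    exact hv (hf v)
  · exact hiv (hU.mem_ptObs_of_pin (hp hi) hj hij hv)

end PL1P

/-! ### Zariski neighbourhoods -/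

section Zariski

variable {𝕜 : Type*} [Field 𝕜] {σ : Type*}

/-- The filter of Zariski neighbourhoods of a point of affine space. -/
def zariskiNhds (c₀ : σ → 𝕜) : Filter (σ → 𝕜) where
  sets := {U | ∃ F : MvPolynomial σ 𝕜, MvPolynomial.eval c₀ F ≠ 0 ∧
    ∀ c, MvPolynomial.eval c F ≠ 0 → c ∈ U}
  univ_sets := ⟨1, by simp, fun _ _ => trivial⟩
  sets_of_superset := fun ⟨F, h1, h2⟩ hs => ⟨F, h1, fun c hc => hs (h2 c hc)⟩
  inter_sets := by
    rintro U V ⟨F, hF, hU⟩ ⟨G, hG, hV⟩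
    refine ⟨F * G, by simp [hF, hG], fun c hc => ?_⟩
    rw [map_mul] at hc
    exact ⟨hU c (left_ne_zero_of_mul hc), hV c (right_ne_zero_of_mul hc)⟩

theorem eventually_eval_ne_zero {c₀ : σ → 𝕜} {F : MvPolynomial σ 𝕜}
    (h : MvPolynomial.eval c₀ F ≠ 0) : ∀ᶠ c in zariskiNhds c₀, MvPolynomial.eval c F ≠ 0 :=
  ⟨F, h, fun _ hc => hc⟩

/-- Genericity is reduced to one example and the openness of the property around its coordinates. -/
theorem GenericOn.of_eventually {α : Type*} {C : α → (σ → 𝕜) → Prop} {Z : Set α} {p : α → Prop}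
    {z : α} (hz : z ∈ Z) {c₀ : σ → 𝕜} (hc : C z c₀)
    (h : ∀ᶠ c in zariskiNhds c₀, ∀ z, C z c → p z) : GenericOn C Z p := by
  obtain ⟨F, hF, h⟩ := h
  exact ⟨F, ⟨z, hz, c₀, hc, hF⟩, fun z _ c hc hF => h c hF z hc⟩

theorem GenericOn.mono {α : Type*} {C : α → (σ → 𝕜) → Prop} {Z : Set α} {p q : α → Prop}
    (h : GenericOn C Z p) (hpq : ∀ z ∈ Z, p z → q z) : GenericOn C Z q := by
  obtain ⟨F, hF, h⟩ := h
  exact ⟨F, hF, fun z hz c hc h0 => hpq z hz (h z hz c hc h0)⟩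

variable (𝕜 σ) in
/-- The polynomial functions on affine space. -/
noncomputable def polyFun : Subalgebra 𝕜 ((σ → 𝕜) → 𝕜) :=
  (MvPolynomial.aeval (R := 𝕜) (fun k (c : σ → 𝕜) => c k)).range

theorem coord_mem_polyFun (k : σ) : (fun c : σ → 𝕜 => c k) ∈ polyFun 𝕜 σ :=
  ⟨MvPolynomial.X k, by simp⟩

theorem const_mem_polyFun (a : 𝕜) : (fun _ : σ → 𝕜 => a) ∈ polyFun 𝕜 σ :=
  (polyFun 𝕜 σ).algebraMap_mem a

theorem sum_mem_polyFun {α : Type*} {s : Finset α} {f : α → (σ → 𝕜) → 𝕜}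
    (h : ∀ a ∈ s, f a ∈ polyFun 𝕜 σ) : (fun c => ∑ a ∈ s, f a c) ∈ polyFun 𝕜 σ := by
  have := sum_mem h
  convert this using 1
  ext c
  simp

theorem mul_mem_polyFun {f g : (σ → 𝕜) → 𝕜} (hf : f ∈ polyFun 𝕜 σ) (hg : g ∈ polyFun 𝕜 σ) :
    (fun c => f c * g c) ∈ polyFun 𝕜 σ :=
  mul_mem hf hg

theorem neg_mem_polyFun {f : (σ → 𝕜) → 𝕜} (hf : f ∈ polyFun 𝕜 σ) :
    (fun c => -f c) ∈ polyFun 𝕜 σ :=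
  neg_mem hf

theorem det_mem_polyFun {k : ℕ} {M : (σ → 𝕜) → Matrix (Fin k) (Fin k) 𝕜}
    (h : ∀ a b, (fun c => M c a b) ∈ polyFun 𝕜 σ) : (fun c => (M c).det) ∈ polyFun 𝕜 σ := by
  simp only [Matrix.det_apply']
  refine sum_mem_polyFun fun τ _ => mul_mem_polyFun (const_mem_polyFun _) ?_
  have := prod_mem (S := polyFun 𝕜 σ) (t := Finset.univ) (f := fun b c => M c (τ b) b)
    fun b _ => h (τ b) b
  convert this using 1
  ext c
  simp

theorem eventually_ne_zero {f : (σ → 𝕜) → 𝕜} (hf : f ∈ polyFun 𝕜 σ) {c₀ : σ → 𝕜} (h : f c₀ ≠ 0) :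
    ∀ᶠ c in zariskiNhds c₀, f c ≠ 0 := by
  obtain ⟨F, rfl⟩ := hf
  have he : ∀ c, (MvPolynomial.aeval (R := 𝕜) (fun k (c : σ → 𝕜) => c k)) F c =
      MvPolynomial.eval c F := by
    clear h
    intro c
    induction F using MvPolynomial.induction_on with
    | C a => simp
    | add p q hp hq => simp_all
    | mul_X p k hp => simp_all
  simp only [AlgHom.toRingHom_eq_coe, RingHom.coe_coe, he] at h ⊢
  exact eventually_eval_ne_zero h

/-- The independent rows `V c₀` have a right inverse `N`. The determinant of `V c * N` is polynomial
in `c` and equals 1 at `c₀`, and the rows are independent wherever it does not vanish. -/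
theorem eventually_linearIndependent {k n : ℕ} {V : (σ → 𝕜) → Fin k → Fin n → 𝕜}
    (hV : ∀ a b, (fun c => V c a b) ∈ polyFun 𝕜 σ) {c₀ : σ → 𝕜}
    (h : LinearIndependent 𝕜 (V c₀)) : ∀ᶠ c in zariskiNhds c₀, LinearIndependent 𝕜 (V c) := by
  have hinj : Function.Injective (Matrix.of (V c₀)).vecMul := Matrix.vecMul_injective_iff.2 h
  obtain ⟨g, hg⟩ := (Matrix.of (V c₀)).vecMulLinear.exists_leftInverse_of_injective
    (LinearMap.ker_eq_bot.2 hinj)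
  let N : Matrix (Fin n) (Fin k) 𝕜 := g.toMatrixRight'
  have hN : Matrix.of (V c₀) * N = 1 := by
    have h1 : ∀ x, Matrix.vecMul x (Matrix.of (V c₀) * N) = x := by
      intro x
      rw [← Matrix.vecMul_vecMul]
      have h2 : ∀ z, Matrix.vecMul z N = g z := fun z =>
        LinearMap.congr_fun (LinearMap.toMatrixRight'.symm_apply_apply g) z
      rw [h2]
      exact LinearMap.congr_fun hg x
    ext a b
    have := congrFun (h1 (Pi.single a 1)) b
    rw [Matrix.single_one_vecMul] at this
    rw [Matrix.one_apply]
    simpa [Pi.single_apply, eq_comm] using this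
  have hdet := eventually_ne_zero (c₀ := c₀) (f := fun c => (Matrix.of (V c) * N).det)
    (det_mem_polyFun fun a b => by
      simp only [Matrix.mul_apply, Matrix.of_apply]
      exact sum_mem_polyFun fun i _ => mul_mem_polyFun (hV a i) (const_mem_polyFun _))
    (by simp [hN])
  filter_upwards [hdet] with c hc
  refine Matrix.vecMul_injective_iff.1 (?_ : Function.Injective (Matrix.of (V c)).vecMul)
  intro x x' hx
  have h1 : Matrix.vecMul (x - x') (Matrix.of (V c) * N) = 0 := by
    rw [← Matrix.vecMul_vecMul, Matrix.sub_vecMul]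
    simp only at hx
    rw [hx, sub_self, Matrix.zero_vecMul]
  exact sub_eq_zero.1 (Matrix.eq_zero_of_vecMul_eq_zero hc h1)

end Zariski

/-! ### Generic scenes -/

section GenericScene

variable {𝕜 : Type*} [Field 𝕜] {ι κ : Type*}

/-- The image in view `v` of the centre of the camera of view `w`. -/
def epipole (P : Fin 3 → Matrix (Fin 3) (Fin 4) 𝕜) (v w : Fin 3) : Fin 3 → 𝕜 :=
  (P v).mulVecLin (camCenter (P w))

/-- No point lies on a line through two camera centres, and no line meets a camera centre. -/
structure Scene.IsNondegenerate (S : Scene 𝕜 ι κ) : Prop where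
  epipole_ne_zero : ∀ v w, w ≠ v → epipole S.cam v w ≠ 0
  apply_pt_ne_zero : ∀ v i, ∀ x ∈ (S.pt i).submodule, (S.cam v).mulVecLin x = 0 → x = 0
  epipole_notMem : ∀ v w, w ≠ v → ∀ i,
    epipole S.cam v w ∉ (S.pt i).submodule.map (S.cam v).mulVecLin
  finrank_line : ∀ v j, finrank 𝕜 ((S.line j).1.map (S.cam v).mulVecLin) = 2

theorem notMem_span_of_linearIndependent_pair {V : Type*} [AddCommGroup V] [Module 𝕜 V] {x e : V}
    (h : LinearIndependent 𝕜 ![x, e]) : e ∉ Submodule.span 𝕜 {x} := by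
  intro hc
  obtain ⟨a, ha⟩ := Submodule.mem_span_singleton.1 hc
  have hx : x ≠ 0 := h.ne_zero 0
  exact (LinearIndependent.pair_iff' hx).1 h a ha

theorem linearIndependent_pair_of_notMem {V : Type*} [AddCommGroup V] [Module 𝕜 V] {x e : V}
    (hx : x ≠ 0) (h : e ∉ Submodule.span 𝕜 {x}) : LinearIndependent 𝕜 ![x, e] :=
  (LinearIndependent.pair_iff' hx).2 fun a ha => h (Submodule.mem_span_singleton.2 ⟨a, ha⟩)

/-- A nondegenerate triple of calibrated cameras. -/
def sampleCam (𝕜 : Type*) [Field 𝕜] : Fin 3 → Matrix (Fin 3) (Fin 4) 𝕜 :=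
  ![!![1, 0, 0, 0; 0, 1, 0, 0; 0, 0, 1, 0], !![1, 0, 0, 1; 0, 1, 0, 0; 0, 0, 1, 0],
    !![1, 0, 0, 0; 0, 1, 0, 1; 0, 0, 1, 0]]

theorem camRot_sampleCam (v : Fin 3) : camRot (sampleCam 𝕜 v) = 1 := by
  ext r s
  fin_cases v <;> fin_cases r <;> fin_cases s <;> simp [camRot, sampleCam]

theorem sampleCam_mem_cameras : sampleCam 𝕜 ∈ cameras 𝕜 := by
  refine ⟨fun v => by simp [camRot_sampleCam], camRot_sampleCam 0, ?_, ?_⟩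
  · ext r
    fin_cases r <;> simp [camTrans, sampleCam]
  · simp [camTrans, sampleCam]

/-- The direction vectors of the line that is used with the cameras `sampleCam`. -/
def sampleLine (𝕜 : Type*) [Field 𝕜] : Fin 2 → Fin 4 → 𝕜 := ![![0, 0, 1, 0], ![1, 1, 0, 0]]

theorem sampleCam_apply_line (v : Fin 3) :
    (sampleCam 𝕜 v).mulVecLin (sampleLine 𝕜 0) = ![0, 0, 1] ∧
    (sampleCam 𝕜 v).mulVecLin (sampleLine 𝕜 1) = ![1, 1, 0] := by
  constructor <;> ext r <;> fin_cases v <;> fin_cases r <;>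
    simp [sampleCam, sampleLine, Matrix.mulVec, dotProduct, Fin.sum_univ_succ]

theorem epipole_sampleCam (v w : Fin 3) :
    epipole (sampleCam 𝕜) v w = camTrans (sampleCam 𝕜 v) - camTrans (sampleCam 𝕜 w) := by
  rw [epipole, Matrix.mulVecLin_apply, mulVec_eq_camRot_add, camRot_sampleCam, Matrix.one_mulVec]
  ext r
  simp [camCenter, camRot_sampleCam, -Fin.reduceLast]
  ring

/-- The epipoles are differences of the translations, nonzero with third coordinate 0, while the
sample point projects to `[0, 0, 1]` in every view. -/
theorem linearIndependent_sampleCam {v w : Fin 3} (h : w ≠ v) :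
    LinearIndependent 𝕜 ![(sampleCam 𝕜 v).mulVecLin (sampleLine 𝕜 0),
      epipole (sampleCam 𝕜) v w] := by
  rw [(sampleCam_apply_line v).1, epipole_sampleCam, LinearIndependent.pair_iff]
  intro s t hst
  have h0 := congrFun hst 0
  have h1 := congrFun hst 1
  have h2 := congrFun hst 2
  fin_cases v <;> fin_cases w <;>
    simp_all [camTrans, sampleCam, Fin.last]

theorem linearIndependent_sampleLine (v : Fin 3) :
    LinearIndependent 𝕜 (fun b => (sampleCam 𝕜 v).mulVecLin (sampleLine 𝕜 b)) := by
  have : (fun b => (sampleCam 𝕜 v).mulVecLin (sampleLine 𝕜 b)) = ![![0, 0, 1], ![1, 1, 0]] := by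
    ext b : 1
    fin_cases b
    exacts [(sampleCam_apply_line v).1, (sampleCam_apply_line v).2]
  rw [this, LinearIndependent.pair_iff]
  intro s t hst
  have h0 := congrFun hst 0
  have h2 := congrFun hst 2
  simp_all

theorem camCenter_mem_polyFun {σ : Type*} {P : (σ → 𝕜) → Matrix (Fin 3) (Fin 4) 𝕜}
    (hP : ∀ r a, (fun c => P c r a) ∈ polyFun 𝕜 σ) (a : Fin 4) :
    (fun c => camCenter (P c) a) ∈ polyFun 𝕜 σ := by
  refine Fin.lastCases ?_ (fun r => ?_) a
  · simp only [camCenter, Fin.snoc_last]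
    exact const_mem_polyFun 1
  · simp only [camCenter, Fin.snoc_castSucc, Pi.neg_apply, Matrix.mulVec, dotProduct]
    exact neg_mem_polyFun (sum_mem_polyFun fun s _ => mul_mem_polyFun (hP _ _) (hP _ _))

theorem mulVecLin_mem_polyFun {σ : Type*} {P : (σ → 𝕜) → Matrix (Fin 3) (Fin 4) 𝕜}
    (hP : ∀ r a, (fun c => P c r a) ∈ polyFun 𝕜 σ) {x : (σ → 𝕜) → Fin 4 → 𝕜}
    (hx : ∀ a, (fun c => x c a) ∈ polyFun 𝕜 σ) (r : Fin 3) :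
    (fun c => (P c).mulVecLin (x c) r) ∈ polyFun 𝕜 σ := by
  simp only [Matrix.mulVecLin_apply, Matrix.mulVec, dotProduct]
  exact sum_mem_polyFun fun s _ => mul_mem_polyFun (hP _ _) (hx _)

/-- The example has all points equal and all lines equal to one line through that point, so every
incidence holds whatever `Q` is. Each nondegeneracy condition is the independence of vectors that
are polynomial in the coordinates. -/
theorem PL1P.genericOn_isNondegenerate [Finite ι] [Finite κ] (Q : PL1P ι κ) :
    GenericOn Scene.HasCoords (Q.sceneVariety 𝕜) Scene.IsNondegenerate := by
  let c₀ : (ι × Fin 4) ⊕ (κ × Fin 2 × Fin 4) ⊕ (Fin 3 × Fin 3 × Fin 4) → 𝕜 :=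
    Sum.elim (fun k => sampleLine 𝕜 0 k.2) (Sum.elim (fun k => sampleLine 𝕜 k.2.1 k.2.2)
      (fun k => sampleCam 𝕜 k.1 k.2.1 k.2.2))
  have hli : LinearIndependent 𝕜 (sampleLine 𝕜) :=
    LinearIndependent.of_comp (sampleCam 𝕜 0).mulVecLin (linearIndependent_sampleLine 0)
  let S : Scene 𝕜 ι κ := ⟨fun _ => Projectivization.mk 𝕜 (sampleLine 𝕜 0) (hli.ne_zero 0),
    fun _ => ⟨Submodule.span 𝕜 (Set.range (sampleLine 𝕜)), by
      rw [finrank_span_eq_card hli]; simp⟩, sampleCam 𝕜⟩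
  have hS : S ∈ Q.sceneVariety 𝕜 := by
    refine ⟨fun i j _ => ?_, sampleCam_mem_cameras⟩
    rw [Projectivization.submodule_mk, Submodule.span_singleton_le_iff_mem]
    exact Submodule.subset_span ⟨0, rfl⟩
  have hc : S.HasCoords c₀ :=
    ⟨fun i => Projectivization.submodule_mk _ _, fun j => rfl, fun v r a => rfl⟩
  refine GenericOn.of_eventually hS hc ?_
  let P (c : (ι × Fin 4) ⊕ (κ × Fin 2 × Fin 4) ⊕ (Fin 3 × Fin 3 × Fin 4) → 𝕜) (v : Fin 3) :
    Matrix (Fin 3) (Fin 4) 𝕜 := fun r a => c (Sum.inr (Sum.inr (v, r, a)))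
  have hP : ∀ v r a, (fun c => P c v r a) ∈ polyFun 𝕜 _ := fun v r a => coord_mem_polyFun _
  have hep : ∀ v w r, (fun c => epipole (P c) v w r) ∈ polyFun 𝕜 _ := fun v w r =>
    mulVecLin_mem_polyFun (hP v) (camCenter_mem_polyFun (hP w)) r
  have e1 : ∀ᶠ c in zariskiNhds c₀, ∀ v w, w ≠ v → LinearIndependent 𝕜 ![epipole (P c) v w] := by
    refine eventually_all.2 fun v => eventually_all.2 fun w => eventually_all.2 fun h =>
      eventually_linearIndependent (fun a b => ?_) ?_
    · obtain rfl : a = 0 := Subsingleton.elim _ _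
      exact hep v w b
    · have h0 : epipole (sampleCam 𝕜) v w ≠ 0 :=
        (linearIndependent_sampleCam (𝕜 := 𝕜) h).ne_zero 1
      exact (linearIndependent_unique_iff (R := 𝕜) (ι := Fin 1)).2 h0
  have e2 : ∀ᶠ c in zariskiNhds c₀, ∀ v w, w ≠ v → ∀ i : ι, LinearIndependent 𝕜
      ![(P c v).mulVecLin (fun a => c (Sum.inl (i, a))), epipole (P c) v w] := by
    refine eventually_all.2 fun v => eventually_all.2 fun w => eventually_all.2 fun h =>
      eventually_all.2 fun i => eventually_linearIndependent (fun a b => ?_) ?_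
    · fin_cases a
      · exact mulVecLin_mem_polyFun (hP v) (fun a => coord_mem_polyFun _) b
      · exact hep v w b
    · exact linearIndependent_sampleCam h
  have e3 : ∀ᶠ c in zariskiNhds c₀, ∀ v, ∀ j : κ, LinearIndependent 𝕜
      (fun b => (P c v).mulVecLin (fun a => c (Sum.inr (Sum.inl (j, b, a))))) := by
    refine eventually_all.2 fun v => eventually_all.2 fun j =>
      eventually_linearIndependent (fun a b => ?_) ?_
    · exact mulVecLin_mem_polyFun (hP v) (fun a => coord_mem_polyFun _) b
    · exact linearIndependent_sampleLine v
  filter_upwards [e1, e2, e3] with c h1 h2 h3 S hS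
  have hcam : S.cam = P c := by
    ext v r a
    exact hS.2.2 v r a
  refine ⟨fun v w h => ?_, fun v i x hx hx0 => ?_, fun v w h i => ?_, fun v j => ?_⟩
  · rw [hcam]
    exact (h1 v w h).ne_zero 0
  · obtain ⟨w, hw⟩ : ∃ w : Fin 3, w ≠ v := exists_ne v
    have := (h2 v w hw i).ne_zero 0
    rw [hS.1 i] at hx
    obtain ⟨a, rfl⟩ := Submodule.mem_span_singleton.1 hx
    rw [map_smul, hcam] at hx0
    rw [(smul_eq_zero.1 hx0).resolve_right this, zero_smul]
  · rw [hS.1 i, Submodule.map_span, Set.image_singleton, hcam]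
    exact notMem_span_of_linearIndependent_pair (h2 v w h i)
  · rw [hS.2.1 j, Submodule.map_span, ← Set.range_comp, hcam]
    refine (finrank_span_eq_card (h3 v j)).trans (by simp)

end GenericScene

namespace PL1P

variable {𝕜 : Type*} [Field 𝕜] {ι κ : Type*} {Q : PL1P ι κ} {K : Kept ι κ}

/-! ### Generic joint images in a fibre -/

/-- No forgotten image feature contains one of the points `e v w`. -/
structure Avoids (e : Fin 3 → Fin 3 → Fin 3 → 𝕜) (K : Kept ι κ) (y : JointImage 𝕜 Q) : Prop where
  pt : ∀ v w, w ≠ v → ∀ i : Q.ptObs v, (i : ι) ∉ K.pts → e v w ∉ (y.pt v i).submodule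
  line : ∀ v w, w ≠ v → ∀ j : Q.lineObs v, (j : κ) ∉ K.lines → e v w ∉ (y.line v j).1

variable (e : Fin 3 → Fin 3 → Fin 3 → 𝕜)

theorem exists_hasCoords (y : JointImage 𝕜 Q) : ∃ d, y.HasCoords d := by
  choose b hb using fun v j => exists_pair_of_finrank_eq_two (y.line v j).2
  exact ⟨Sum.elim (fun k => (y.pt k.1.1 k.1.2).rep k.2) (fun k => b k.1.1 k.1.2 k.2.1 k.2.2),
    fun v i => (y.pt v i).submodule_eq, fun v j => hb v j⟩

theorem Avoids.eventually [Finite ι] [Finite κ] {y : JointImage 𝕜 Q} (h : Avoids e K y)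
    {d₀ : ((Σ v, Q.ptObs v) × Fin 3) ⊕ ((Σ v, Q.lineObs v) × Fin 2 × Fin 3) → 𝕜}
    (hd : y.HasCoords d₀) :
    ∀ᶠ d in zariskiNhds d₀, ∀ y : JointImage 𝕜 Q, y.HasCoords d → Avoids e K y := by
  have e1 : ∀ᶠ d in zariskiNhds d₀, ∀ v w, w ≠ v → ∀ i : Q.ptObs v, (i : ι) ∉ K.pts →
      LinearIndependent 𝕜 ![fun a => d (Sum.inl (⟨v, i⟩, a)), e v w] := by
    refine eventually_all.2 fun v => eventually_all.2 fun w => eventually_all.2 fun hw =>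
      eventually_all.2 fun i => eventually_all.2 fun hi =>
      eventually_linearIndependent (fun a b => ?_) ?_
    · fin_cases a
      · exact coord_mem_polyFun _
      · exact const_mem_polyFun _
    · have h1 := h.pt v w hw i hi
      have h2 := (y.pt v i).finrank_submodule
      rw [hd.1] at h1 h2
      refine linearIndependent_pair_of_notMem (fun h0 => ?_) h1
      rw [h0, Submodule.span_zero_singleton, finrank_bot] at h2
      exact zero_ne_one h2
  have e2 : ∀ᶠ d in zariskiNhds d₀, ∀ v w, w ≠ v → ∀ j : Q.lineObs v, (j : κ) ∉ K.lines →
      LinearIndependent 𝕜 (Fin.cons (e v w)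
        (fun b : Fin 2 => fun a => d (Sum.inr (⟨v, j⟩, b, a))) : Fin 3 → Fin 3 → 𝕜) := by
    refine eventually_all.2 fun v => eventually_all.2 fun w => eventually_all.2 fun hw =>
      eventually_all.2 fun j => eventually_all.2 fun hj =>
      eventually_linearIndependent (fun a b => ?_) ?_
    · refine Fin.cases ?_ (fun a => ?_) a
      · exact const_mem_polyFun _
      · exact coord_mem_polyFun _
    · have h1 := h.line v w hw j hj
      have h2 := (y.line v j).2
      rw [hd.2] at h1 h2
      exact linearIndependent_finCons.2 ⟨linearIndependent_of_finrank_span h2, h1⟩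
  filter_upwards [e1, e2] with d h1 h2 y hy
  refine ⟨fun v w hw i hi => ?_, fun v w hw j hj => ?_⟩
  · rw [hy.1]
    exact notMem_span_of_linearIndependent_pair (h1 v w hw i hi)
  · rw [hy.2]
    exact (linearIndependent_finCons.1 (h2 v w hw j hj)).2

theorem exists_line_forall_notMem [Infinite 𝕜] {α : Type*} [Finite α] (e : α → Fin 3 → 𝕜)
    (he : ∀ a, e a ≠ 0) : ∃ l : Line 𝕜 3, ∀ a, e a ∉ l.1 := by
  obtain ⟨l, -⟩ := exists_line_through (𝕜 := 𝕜) (n := 3) (by omega) (x := Pi.single 0 1) (by simp)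
  obtain ⟨p, -, hp, hpe⟩ := exists_point_avoiding l e he
  obtain ⟨l', -, hl'⟩ := exists_line_avoiding hp e hpe
  exact ⟨l', hl'⟩

/-- Image points are chosen before image lines. A forgotten point is put on the image of its kept
pin, of which there is at most one, away from the epipoles. A forgotten line can then avoid the
epipoles too, because the point it must contain, kept or not, is not one of them. -/
theorem exists_avoids [Infinite 𝕜] (he : ∀ v w, w ≠ v → e v w ≠ 0)
    {y' : JointImage 𝕜 (Q.restrict K)}
    (hy' : y' ∈ (Q.restrict K).imageVariety 𝕜)
    (hpt : ∀ v w, w ≠ v → ∀ i, e v w ∉ (y'.pt v i).submodule)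
    (hpins : ∀ i ∉ K.pts, ∀ j ∈ K.lines, ∀ j' ∈ K.lines, Q.inc i j → Q.inc i j' → j = j') :
    ∃ y ∈ Q.imageVariety 𝕜, Q.forgetImage K y = y' ∧ Avoids e K y := by
  have exists_pt : ∀ v (i : Q.ptObs v), ∃ p : Projectivization 𝕜 (Fin 3 → 𝕜),
      (∀ hi : (i : ι) ∈ K.pts, p = y'.pt v ⟨⟨i, hi⟩, i.2⟩) ∧
      (∀ (j : Q.lineObs v) (hj : (j : κ) ∈ K.lines), Q.inc i j →
        p.submodule ≤ (y'.line v ⟨⟨j, hj⟩, j.2⟩).1) ∧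
      ∀ w, w ≠ v → e v w ∉ p.submodule := by
    intro v i
    by_cases hi : (i : ι) ∈ K.pts
    · exact ⟨_, fun _ => rfl, fun j hj hij => hy' v ⟨⟨i, hi⟩, i.2⟩ ⟨⟨j, hj⟩, j.2⟩ hij,
        fun w hw => hpt v w hw _⟩
    · obtain ⟨l, hl⟩ : ∃ l : Line 𝕜 3, ∀ (j : Q.lineObs v) (hj : (j : κ) ∈ K.lines), Q.inc i j →
          l = y'.line v ⟨⟨j, hj⟩, j.2⟩ := by
        by_cases hj : ∃ j : Q.lineObs v, (j : κ) ∈ K.lines ∧ Q.inc i j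
        · obtain ⟨j, hj, hij⟩ := hj
          refine ⟨y'.line v ⟨⟨j, hj⟩, j.2⟩, fun j' hj' hij' => ?_⟩
          obtain rfl : j = j' := Subtype.ext (hpins i hi j hj j' hj' hij hij')
          rfl
        · obtain ⟨l, -⟩ := exists_line_through (𝕜 := 𝕜) (n := 3) (by omega)
            (x := Pi.single 0 1) (by simp)
          exact ⟨l, fun j hj' hij => absurd ⟨j, hj', hij⟩ hj⟩
      obtain ⟨p, hp, hp0, hpe⟩ := exists_point_avoiding l (fun w : {w // w ≠ v} => e v w)
        fun w => he v w w.2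
      refine ⟨Projectivization.mk 𝕜 p hp0, fun h => absurd h hi, fun j hj hij => ?_,
        fun w hw => ?_⟩
      · rw [Projectivization.submodule_mk, Submodule.span_singleton_le_iff_mem, ← hl j hj hij]
        exact hp
      · rw [Projectivization.submodule_mk]
        exact hpe ⟨w, hw⟩
  choose p hpK hpl hpe using exists_pt
  have exists_line : ∀ v (j : Q.lineObs v), ∃ l : Line 𝕜 3,
      (∀ hj : (j : κ) ∈ K.lines, l = y'.line v ⟨⟨j, hj⟩, j.2⟩) ∧
      (∀ i : Q.ptObs v, Q.inc i j → (p v i).submodule ≤ l.1) ∧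
      ((j : κ) ∉ K.lines → ∀ w, w ≠ v → e v w ∉ l.1) := by
    intro v j
    by_cases hj : (j : κ) ∈ K.lines
    · exact ⟨_, fun _ => rfl, fun i hij => hpl v i j hj hij, fun h => absurd hj h⟩
    · by_cases hi : ∃ i : Q.ptObs v, Q.inc i j
      · obtain ⟨i, hij⟩ := hi
        obtain ⟨l, hl, hle⟩ := exists_line_avoiding (p v i).rep_nonzero
          (fun w : {w // w ≠ v} => e v w) fun w => by
            rw [← Projectivization.submodule_eq]
            exact hpe v i w w.2
        refine ⟨l, fun h => absurd h hj, fun i' hij' => ?_, fun _ w hw => hle ⟨w, hw⟩⟩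
        obtain rfl : i = i' := Subtype.ext (Q.inc_unique i i' j hij hij')
        rwa [Projectivization.submodule_eq, Submodule.span_singleton_le_iff_mem]
      · obtain ⟨l, hl⟩ := exists_line_forall_notMem (fun w : {w // w ≠ v} => e v w)
          fun w => he v w w.2
        exact ⟨l, fun h => absurd h hj, fun i hij => absurd ⟨i, hij⟩ hi, fun _ w hw => hl ⟨w, hw⟩⟩
  choose l hlK hlp hle using exists_line
  refine ⟨⟨p, l⟩, fun v i j hij => hlp v j i hij, ?_, fun v w hw i _ => hpe v i w hw,
    fun v w hw j hj => hle v j hj w hw⟩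
  ext v i : 3
  · exact hpK v ⟨i.1.1, i.2⟩ i.1.2
  · exact hlK v ⟨i.1.1, i.2⟩ i.1.2

/-! ### Sufficient conditions for reducibility -/

/-- A nonzero vector in the kernel of camera `v` spans its centre, whose image in `w` is the
epipole. -/
theorem eq_zero_of_epipole_notMem {P : Fin 3 → Matrix (Fin 3) (Fin 4) 𝕜} (hP : P ∈ cameras 𝕜)
    {v w : Fin 3} {W : Submodule 𝕜 (Fin 3 → 𝕜)} (hW : epipole P w v ∉ W) {x : Fin 4 → 𝕜}
    (hx : (P v).mulVecLin x = 0) (hxW : (P w).mulVecLin x ∈ W) : x = 0 := by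
  obtain ⟨a, rfl⟩ := eq_smul_camCenter hP v hx
  rw [map_smul] at hxW
  by_cases ha : a = 0
  · rw [ha, zero_smul]
  · exact absurd ((W.smul_mem_iff ha).1 hxW) hW

/-- Conditions on the forgotten features under which generic joint images can be lifted. -/
structure IsForgettable (Q : PL1P ι κ) (K : Kept ι κ) : Prop where
  line : ∀ j ∉ K.lines, ∃ v, j ∉ Q.lineObs v
  pin : ∀ i ∈ K.pts, ∀ j ∉ K.lines, Q.inc i j → ∀ v, j ∈ Q.lineObs v → i ∈ Q.ptObs v
  pt_view : ∀ i ∉ K.pts, ∀ v w, i ∈ Q.ptObs v → i ∈ Q.ptObs w → v = w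
  pt_with_pins : ∀ i ∉ K.pts, (∀ j ∈ K.lines, ¬ Q.inc i j) → ∀ v, i ∈ Q.ptObs v →
    ∃ w, w ≠ v ∧ ∀ j, Q.inc i j → j ∉ Q.lineObs w
  kept_pin : ∀ i ∉ K.pts, ∀ j ∈ K.lines, Q.inc i j → ∀ v, i ∈ Q.ptObs v → j ∈ Q.lineObs v
  other_pin : ∀ i ∉ K.pts, ∀ j ∈ K.lines, Q.inc i j → ∀ j' ∉ K.lines, Q.inc i j' →
    ∀ v, j' ∈ Q.lineObs v → i ∈ Q.ptObs v
  kept_pin_unique : ∀ i ∉ K.pts, ∀ j ∈ K.lines, ∀ j' ∈ K.lines, Q.inc i j → Q.inc i j' → j = j'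

variable {S' : Scene 𝕜 K.pts K.lines} {y : JointImage 𝕜 Q}

/-- A line of the image plane that equals the image of each forgotten pin of the point `i` and
contains no epipole. -/
theorem exists_line_of_pins [Infinite 𝕜] (he : ∀ v w, w ≠ v → e v w ≠ 0) (ha : Avoids e K y)
    {i : ι} (hpins : ∀ j ∈ K.lines, ¬ Q.inc i j) {u : Fin 3} (hu : i ∉ Q.ptObs u) :
    ∃ l : Line 𝕜 3, (∀ j : Q.lineObs u, Q.inc i j → l = y.line u j) ∧
      ∀ w, w ≠ u → e u w ∉ l.1 := by
  by_cases hj : ∃ j : Q.lineObs u, Q.inc i j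
  · obtain ⟨j, hij⟩ := hj
    refine ⟨y.line u j, fun j' hij' => ?_, fun w hw => ha.line u w hw j fun h => hpins j h hij⟩
    obtain rfl : j = j' := by
      by_contra hne
      exact hu (Q.obs_meet u i j j' (fun h => hne (Subtype.ext h)) hij hij' j.2 j'.2)
    rfl
  · obtain ⟨l, hl⟩ := exists_line_forall_notMem (fun w : {w // w ≠ u} => e u w)
      fun w => he u w w.2
    exact ⟨l, fun j hij => absurd ⟨j, hij⟩ hj, fun w hw => hl ⟨w, hw⟩⟩

/-- A kept point is its own lift. With a kept pin, the at most one observation of the point is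
pulled back to that pin. Without one, back-projected rays and planes are intersected. A line through
the lift is constrained only in views that do not observe the point; elsewhere the image incidence
suffices. -/
theorem exists_point_lift [Infinite 𝕜] (hK : Q.IsForgettable K)
    (hS' : S' ∈ (Q.restrict K).sceneVariety 𝕜) (hnd : S'.IsNondegenerate)
    (hy : y ∈ Q.imageVariety 𝕜) (hproj : (Q.restrict K).Projects S' (Q.forgetImage K y))
    (ha : Avoids (epipole S'.cam) K y) (i : ι) :
    ∃ x : Fin 4 → 𝕜, x ≠ 0 ∧ (∀ hi : i ∈ K.pts, x = (S'.pt ⟨i, hi⟩).rep) ∧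
      (∀ v (hi : i ∈ Q.ptObs v), (S'.cam v).mulVecLin x ∈ (y.pt v ⟨i, hi⟩).submodule ∧
        (S'.cam v).mulVecLin x ≠ 0) ∧
      (∀ j ∉ K.lines, Q.inc i j → ∀ v (hj : j ∈ Q.lineObs v), i ∉ Q.ptObs v →
        (S'.cam v).mulVecLin x ∈ (y.line v ⟨j, hj⟩).1 ∧ (S'.cam v).mulVecLin x ≠ 0) ∧
      ∀ j (hj : j ∈ K.lines), Q.inc i j → x ∈ (S'.line ⟨j, hj⟩).1 := by
  have hP := hS'.2
  have hsurj := mulVecLin_surjective hP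
  by_cases hi : i ∈ K.pts
  · have h0 := (S'.pt ⟨i, hi⟩).rep_nonzero
    refine ⟨_, h0, fun _ => rfl, fun v hv => ⟨?_, fun hz => h0 ?_⟩,
      fun j hj hij v hv hiv => absurd (hK.pin i hi j hj hij v hv) hiv,
      fun j hj hij => hS'.1 ⟨i, hi⟩ ⟨j, hj⟩ hij (rep_mem_submodule _)⟩
    · exact hproj.apply_mem_pt ⟨⟨i, hi⟩, hv⟩ (rep_mem_submodule _)
    · exact hnd.apply_pt_ne_zero v _ _ (rep_mem_submodule _) hz
  by_cases hpins : ∃ j ∈ K.lines, Q.inc i j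
  · obtain ⟨j, hj, hij⟩ := hpins
    suffices h : ∃ x ∈ (S'.line ⟨j, hj⟩).1, x ≠ 0 ∧ ∀ v (hi : i ∈ Q.ptObs v),
        (S'.cam v).mulVecLin x ∈ (y.pt v ⟨i, hi⟩).submodule ∧ (S'.cam v).mulVecLin x ≠ 0 by
      obtain ⟨x, hx, hx0, hxp⟩ := h
      refine ⟨x, hx0, fun h => absurd h hi, hxp, fun j' hj' hij' v hv hiv =>
        absurd (hK.other_pin i hi j hj hij j' hj' hij' v hv) hiv, fun j' hj' hij' => ?_⟩
      obtain rfl := hK.kept_pin_unique i hi j hj j' hj' hij hij'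
      exact hx
    by_cases hv : ∃ v, i ∈ Q.ptObs v
    · obtain ⟨v, hv⟩ := hv
      have hjv := hK.kept_pin i hi j hj hij v hv
      obtain ⟨x, hx, hxp⟩ : (y.pt v ⟨i, hv⟩).rep ∈
          (S'.line ⟨j, hj⟩).1.map (S'.cam v).mulVecLin := by
        rw [hproj.2 v ⟨⟨j, hj⟩, hjv⟩]
        exact hy v ⟨i, hv⟩ ⟨j, hjv⟩ hij (rep_mem_submodule _)
      refine ⟨x, hx, fun h => (y.pt v ⟨i, hv⟩).rep_nonzero (by rw [← hxp, h, map_zero]),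
        fun v' hv' => ?_⟩
      obtain rfl := hK.pt_view i hi v v' hv hv'
      rw [hxp]
      exact ⟨rep_mem_submodule _, Projectivization.rep_nonzero _⟩
    · obtain ⟨x, hx, hx0⟩ := exists_mem_ne_zero_of_finrank_pos (𝕜 := 𝕜)
        (L := (S'.line ⟨j, hj⟩).1) (by rw [(S'.line _).2]; omega)
      exact ⟨x, hx, hx0, fun v hv' => absurd ⟨v, hv'⟩ hv⟩
  push Not at hpins
  suffices h : ∃ x : Fin 4 → 𝕜, x ≠ 0 ∧
      (∀ v (hi : i ∈ Q.ptObs v), (S'.cam v).mulVecLin x ∈ (y.pt v ⟨i, hi⟩).submodule ∧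
        (S'.cam v).mulVecLin x ≠ 0) ∧
      (∀ j ∉ K.lines, Q.inc i j → ∀ v (hj : j ∈ Q.lineObs v), i ∉ Q.ptObs v →
        (S'.cam v).mulVecLin x ∈ (y.line v ⟨j, hj⟩).1 ∧ (S'.cam v).mulVecLin x ≠ 0) by
    obtain ⟨x, hx0, h1, h2⟩ := h
    exact ⟨x, hx0, fun h => absurd h hi, h1, h2, fun j hj hij => absurd hij (hpins j hj)⟩
  by_cases hv : ∃ v, i ∈ Q.ptObs v
  · obtain ⟨v, hv⟩ := hv
    have hview : ∀ u, i ∈ Q.ptObs u → u = v := fun u hu => hK.pt_view i hi u v hu hv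
    -- View `w` imposes nothing. The ray from `v` and a plane from the third view `u` meet in
    -- dimension at least 2 + 3 - 4 = 1.
    obtain ⟨w, hwv, hw⟩ := hK.pt_with_pins i hi hpins v hv
    obtain ⟨u, huv, hall⟩ : ∃ u, u ≠ v ∧ ∀ a, a = v ∨ a = w ∨ a = u := by
      clear * - hwv
      revert v w; decide
    obtain ⟨l, hl, hle⟩ := exists_line_of_pins _ hnd.epipole_ne_zero ha hpins
      (fun h => huv (hview u h))
    obtain ⟨x, ⟨hxp, hxl⟩, hx0⟩ := exists_mem_ne_zero_of_finrank_pos (𝕜 := 𝕜)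
      (L := (y.pt v ⟨i, hv⟩).submodule.comap (S'.cam v).mulVecLin ⊓
        l.1.comap (S'.cam u).mulVecLin) (by
        have := finrank_add_le_finrank_inf
          ((y.pt v ⟨i, hv⟩).submodule.comap (S'.cam v).mulVecLin)
          (l.1.comap (S'.cam u).mulVecLin)
        rw [finrank_comap_of_surjective (hsurj v), finrank_comap_of_surjective (hsurj u),
          finrank_ker_of_surjective (hsurj v), finrank_ker_of_surjective (hsurj u),
          Projectivization.finrank_submodule, l.2, finrank_fin_fun] at this
        omega)
    refine ⟨x, hx0, fun v' hv' => ?_, fun j hj hij v' hjv' hv' => ?_⟩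
    · obtain rfl := hview v' hv'
      exact ⟨hxp, fun h => hx0 (eq_zero_of_epipole_notMem hP (hle v' huv.symm) h hxl)⟩
    · obtain rfl | rfl | rfl := hall v'
      · exact absurd hv hv'
      · exact absurd hjv' (hw j hij)
      · rw [← hl ⟨j, hjv'⟩ hij]
        exact ⟨hxl, fun h => hx0 (eq_zero_of_epipole_notMem hP (ha.pt v v' huv ⟨i, hv⟩ hi) h hxp)⟩
  · push Not at hv
    -- Each view gives at most one plane, since two observed pins would reveal the point. Three
    -- planes meet in dimension at least 3 · 3 - 2 · 4 = 1.
    choose l hl hle using fun u => exists_line_of_pins _ hnd.epipole_ne_zero ha hpins (hv u)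
    let W := fun u => (l u).1.comap (S'.cam u).mulVecLin
    have hW : ∀ u, finrank 𝕜 (W u) = 3 := fun u => by
      rw [finrank_comap_of_surjective (hsurj u), finrank_ker_of_surjective (hsurj u), (l u).2]
    obtain ⟨x, ⟨hx01, hx2⟩, hx0⟩ := exists_mem_ne_zero_of_finrank_pos (𝕜 := 𝕜)
      (L := W 0 ⊓ W 1 ⊓ W 2) (by
        have h1 := finrank_add_le_finrank_inf (W 0) (W 1)
        have h2 := finrank_add_le_finrank_inf (W 0 ⊓ W 1) (W 2)
        simp only [hW, finrank_fin_fun] at h1 h2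
        omega)
    have hx : ∀ u, (S'.cam u).mulVecLin x ∈ (l u).1 := by
      intro u
      fin_cases u
      exacts [hx01.1, hx01.2, hx2]
    refine ⟨x, hx0, fun v h => absurd h (hv v), fun j hj hij v hjv _ => ⟨?_, fun h => hx0 ?_⟩⟩
    · rw [← hl v ⟨j, hjv⟩ hij]
      exact hx v
    · obtain ⟨w, hw⟩ : ∃ w : Fin 3, w ≠ v := exists_ne v
      exact eq_zero_of_epipole_notMem hP (hle w v hw.symm) h (hx w)

/-- A forgotten line misses some view. If both other views see it, the two back-projected planes
determine it, and it contains a prescribed point because the images of that point lie on both image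
lines. If at most one view sees it, there is freedom to draw it through a chosen point. -/
theorem exists_line_lift (hK : Q.IsForgettable K)
    (hS' : S' ∈ (Q.restrict K).sceneVariety 𝕜)
    (hproj : (Q.restrict K).Projects S' (Q.forgetImage K y))
    (ha : Avoids (epipole S'.cam) K y) (x : ι → Fin 4 → 𝕜) (hx0 : ∀ i, x i ≠ 0) (j : κ)
    (hx : ∀ i, Q.inc i j → ∀ v (hj : j ∈ Q.lineObs v), j ∉ K.lines →
      (S'.cam v).mulVecLin (x i) ∈ (y.line v ⟨j, hj⟩).1 ∧ (S'.cam v).mulVecLin (x i) ≠ 0)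
    (hxK : ∀ i, ∀ hj : j ∈ K.lines, Q.inc i j → x i ∈ (S'.line ⟨j, hj⟩).1) :
    ∃ L : Line 𝕜 4, (∀ hj : j ∈ K.lines, L = S'.line ⟨j, hj⟩) ∧
      (∀ v (hj : j ∈ Q.lineObs v), L.1.map (S'.cam v).mulVecLin = (y.line v ⟨j, hj⟩).1) ∧
      ∀ i, Q.inc i j → x i ∈ L.1 := by
  have hP := hS'.2
  have hsurj := mulVecLin_surjective hP
  by_cases hj : j ∈ K.lines
  · exact ⟨_, fun _ => rfl, fun v hv => hproj.2 v ⟨⟨j, hj⟩, hv⟩, fun i hij => hxK i hj hij⟩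
  obtain ⟨u, hu⟩ := hK.line j hj
  obtain ⟨v, w, hvw, hall⟩ : ∃ v w, v ≠ w ∧ ∀ a, a = u ∨ a = v ∨ a = w := by
    clear * -
    revert u; decide
  by_cases hvw' : j ∈ Q.lineObs v ∧ j ∈ Q.lineObs w
  · obtain ⟨hv, hw⟩ := hvw'
    obtain ⟨L, hL, hLv, hLw⟩ := exists_line_map_eq_map_eq (hsurj v) (hsurj w)
      (y.line v ⟨j, hv⟩) (y.line w ⟨j, hw⟩)
      (fun x h h' => eq_zero_of_epipole_notMem hP (ha.line w v hvw ⟨j, hw⟩ hj) h h')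
      (fun x h h' => eq_zero_of_epipole_notMem hP (ha.line v w hvw.symm ⟨j, hv⟩ hj) h h')
    refine ⟨L, fun h => absurd h hj, fun a haj => ?_, fun i hij => ?_⟩
    · obtain rfl | rfl | rfl := hall a
      exacts [absurd haj hu, hLv, hLw]
    · rw [hL]
      exact ⟨(hx i hij v hv hj).1, (hx i hij w hw hj).1⟩
  · have hone : ∀ a b, j ∈ Q.lineObs a → j ∈ Q.lineObs b → a = b := by
      intro a b h1 h2
      obtain rfl | rfl | rfl := hall a <;> obtain rfl | rfl | rfl := hall b
      exacts [rfl, absurd h1 hu, absurd h1 hu, absurd h2 hu, rfl, absurd ⟨h1, h2⟩ hvw',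
        absurd h2 hu, absurd ⟨h2, h1⟩ hvw', rfl]
    -- `z` is the prescribed point if the line is a pin, else a preimage of a point of the observed
    -- image line, else an arbitrary nonzero vector, for which a camera centre serves.
    obtain ⟨z, hz0, hzx, hz⟩ : ∃ z : Fin 4 → 𝕜, z ≠ 0 ∧ (∀ i, Q.inc i j → x i = z) ∧
        ∀ v (hv : j ∈ Q.lineObs v), (S'.cam v).mulVecLin z ∈ (y.line v ⟨j, hv⟩).1 ∧
          (S'.cam v).mulVecLin z ≠ 0 := by
      by_cases hi : ∃ i, Q.inc i j
      · obtain ⟨i, hij⟩ := hi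
        exact ⟨x i, hx0 i, fun i' hij' => by rw [Q.inc_unique i i' j hij hij'],
          fun v hv => hx i hij v hv hj⟩
      · by_cases hv : ∃ v, j ∈ Q.lineObs v
        · obtain ⟨v, hv⟩ := hv
          obtain ⟨q, hq, hq0⟩ := exists_mem_ne_zero_of_finrank_pos (𝕜 := 𝕜)
            (L := (y.line v ⟨j, hv⟩).1) (by rw [(y.line v _).2]; omega)
          obtain ⟨z, rfl⟩ := hsurj v q
          refine ⟨z, fun h => hq0 (by rw [h, map_zero]), fun i hij => absurd ⟨i, hij⟩ hi,
            fun v' hv' => ?_⟩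
          obtain rfl := hone v v' hv hv'
          exact ⟨hq, hq0⟩
        · exact ⟨_, camCenter_ne_zero (S'.cam 0), fun i hij => absurd ⟨i, hij⟩ hi,
            fun v h => absurd ⟨v, h⟩ hv⟩
    by_cases hv : ∃ v, j ∈ Q.lineObs v
    · obtain ⟨v, hv⟩ := hv
      obtain ⟨L, hL, hLv⟩ := exists_line_map_eq (hsurj v) (y.line v ⟨j, hv⟩) (hz v hv).1 (hz v hv).2
      refine ⟨L, fun h => absurd h hj, fun a haj => ?_, fun i hij => by rwa [hzx i hij]⟩
      obtain rfl := hone v a hv haj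
      exact hLv
    · obtain ⟨L, hL⟩ := exists_line_through (by omega) hz0
      exact ⟨L, fun h => absurd h hj, fun a haj => absurd ⟨a, haj⟩ hv,
        fun i hij => by rwa [hzx i hij]⟩

theorem exists_lift [Infinite 𝕜] (hK : Q.IsForgettable K)
    (hS' : S' ∈ (Q.restrict K).sceneVariety 𝕜) (hnd : S'.IsNondegenerate)
    (hy : y ∈ Q.imageVariety 𝕜) (hproj : (Q.restrict K).Projects S' (Q.forgetImage K y))
    (ha : Avoids (epipole S'.cam) K y) :
    ∃ S ∈ Q.sceneVariety 𝕜, Q.Projects S y ∧ forgetScene K S = S' := by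
  choose x hx0 hxK hxp hxl hxL using exists_point_lift hK hS' hnd hy hproj ha
  choose L hLK hLm hLx using fun j => exists_line_lift hK hS' hproj ha x hx0 j
    (fun i hij v hjv hj => by
      by_cases hi : i ∈ Q.ptObs v
      · exact ⟨hy v ⟨i, hi⟩ ⟨j, hjv⟩ hij (hxp i v hi).1, (hxp i v hi).2⟩
      · exact hxl i j hj hij v hjv hi) (fun i hj hij => hxL i j hj hij)
  refine ⟨⟨fun i => Projectivization.mk 𝕜 (x i) (hx0 i), L, S'.cam⟩, ⟨fun i j hij => ?_, hS'.2⟩,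
    ⟨fun v i => ?_, fun v j => hLm j v j.2⟩, ?_⟩
  · rw [Projectivization.submodule_mk, Submodule.span_singleton_le_iff_mem]
    exact hLx j i hij
  · rw [Projectivization.submodule_mk, Submodule.map_span, Set.image_singleton]
    exact (eq_span_singleton_of_finrank_le_one (y.pt v i).finrank_submodule.le
      (hxp i v i.2).1 (hxp i v i.2).2).symm
  · ext i : 2
    · refine Eq.trans ?_ (Projectivization.mk_rep _)
      simp only [forgetScene]
      congr 1
      exact hxK i i.2
    · exact hLK i i.2
    · rfl

/-- A nondegenerate `S'` has an image `y'`. Avoiding the epipoles is an open condition on the fibre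
over `y'`, nonempty by `exists_avoids`, and it is all that lifting needs. -/
theorem IsForgettable.isReducibleTo [Infinite 𝕜] [Finite ι] [Finite κ] (hK : Q.IsForgettable K) :
    Q.IsReducibleTo 𝕜 K := by
  refine ⟨hK.kept_pin_unique, (Q.restrict K).genericOn_isNondegenerate.mono fun S' hS' hnd => ?_⟩
  let y' : JointImage 𝕜 (Q.restrict K) :=
    ⟨fun v i => Projectivization.mk'' ((S'.pt i).submodule.map (S'.cam v).mulVecLin)
      ((finrank_map_eq_of_inf_ker (hnd.apply_pt_ne_zero v i)).trans
        (S'.pt i).finrank_submodule),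
     fun v j => ⟨(S'.line j).1.map (S'.cam v).mulVecLin, hnd.finrank_line v j⟩⟩
  have hpt : ∀ v i, (y'.pt v i).submodule = (S'.pt i).submodule.map (S'.cam v).mulVecLin :=
    fun v i => Projectivization.submodule_mk'' _ _
  have hproj : (Q.restrict K).Projects S' y' := ⟨fun v i => (hpt v i).symm, fun v j => rfl⟩
  have hy' : y' ∈ (Q.restrict K).imageVariety 𝕜 := by
    intro v i j hij
    rw [hpt]
    exact Submodule.map_mono (hS'.1 i j hij)
  obtain ⟨y, hy, hyK, ha⟩ := exists_avoids (epipole S'.cam) hnd.epipole_ne_zero hy'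
    (fun v w hw i => by rw [hpt]; exact hnd.epipole_notMem v w hw i) hK.kept_pin_unique
  obtain ⟨d, hd⟩ := exists_hasCoords y
  have hgen : GenericOn JointImage.HasCoords
      {y | y ∈ Q.imageVariety 𝕜 ∧ Q.forgetImage K y = y'} (Avoids (epipole S'.cam) K) :=
    GenericOn.of_eventually ⟨hy, hyK⟩ hd (ha.eventually _ hd)
  refine ⟨y', hproj, hgen.mono ?_⟩
  rintro z ⟨hz, hzK⟩ haz
  exact exists_lift hK hS' hnd hz (hzK ▸ hproj) haz

variable (Q) in
-- A kept pin of a point outside the core must be seen in all views, as the other way into the core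
-- goes through a core point. Its other pins are then seen only where the point is, and two kept
-- pins would make the point observed in all views, against `view`.
theorem isForgettable_core : Q.IsForgettable Q.core := by
  have full : ∀ {i j}, i ∉ Q.core.pts → j ∈ Q.core.lines → Q.inc i j → ∀ v, j ∈ Q.lineObs v := by
    intro i j hi hj hij
    obtain h | ⟨i', hi', hij', -⟩ := mem_core_lines.1 hj
    · exact h
    · exact absurd (Q.inc_unique i i' j hij hij' ▸ hi') hi
  have view : ∀ i ∉ Q.core.pts, ∀ v w, i ∈ Q.ptObs v → i ∈ Q.ptObs w → v = w := by
    intro i hi v w hv hw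
    by_contra hne
    exact hi (mem_core_pts.2 ⟨w, hw, Or.inl ⟨v, hne, hv⟩⟩)
  have line : ∀ j ∉ Q.core.lines, ∃ v, j ∉ Q.lineObs v := by
    intro j hj
    by_contra! h
    exact hj (mem_core_lines.2 (Or.inl h))
  refine ⟨line, fun i hi j hj hij v hv => ?_, view, fun i hi hpins v hv => ?_,
    fun i hi j hj hij v _ => full hi hj hij v, fun i hi j hj hij j' hj' hij' v hv => ?_,
    fun i hi j hj j' hj' hij hij' => ?_⟩
  · by_contra hiv
    exact hj (mem_core_lines_of_pin hi hij hv hiv)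
  · by_contra! h
    exact hi (mem_core_pts.2 ⟨v, hv, Or.inr ⟨h, fun j hij => line j fun hj => hpins j hj hij⟩⟩)
  · exact mem_ptObs_of_full_pin hij hij' (fun h => hj' (h ▸ hj)) (full hi hj hij) hv
  · by_contra hne
    have h : ∀ v, i ∈ Q.ptObs v := fun v =>
      mem_ptObs_of_full_pin hij hij' hne (full hi hj hij) (full hi hj' hij' v)
    exact absurd (view i hi 0 1 (h 0) (h 1)) (by decide)

end PL1P

end PLP

/-! ### The theorem, assembled from the properties of the core -/

theorem theorem7 {𝕜 : Type*} [RCLike 𝕜] {ι κ : Type*} [Finite ι] [Finite κ]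
    (Q : PLP.PL1P ι κ) (hQ : Q.IsCameraMinimal 𝕜) :
    ∃ K : PLP.Kept ι κ,
      (Q.IsReducibleTo 𝕜 K ∧ (Q.restrict K).IsReduced 𝕜) ∧
      (∀ K' : PLP.Kept ι κ,
        Q.IsReducibleTo 𝕜 K' → (Q.restrict K').IsReduced 𝕜 → K' = K) ∧
      (∀ K' : PLP.Kept ι κ, Q.IsExhausted K' ↔ K' = K) := by
  refine ⟨Q.core, ⟨Q.isForgettable_core.isReducibleTo, fun K hK => ?_⟩, fun K' hK' hred => ?_,
    fun K' => ⟨fun h => h.eq_core, fun h => h ▸ Q.isExhausted_core⟩⟩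
  · obtain ⟨hp, hl⟩ := hK.core_subset
    rw [PLP.PL1P.core_restrict_core] at hp hl
    exact PLP.Kept.ext (Set.univ_subset_iff.1 hp) (Set.univ_subset_iff.1 hl)
  · obtain ⟨hp, hl⟩ := hK'.core_subset
    exact PLP.PL1P.eq_core_of_core_restrict_eq_all hp hl
      -- Reducedness is applied to the reduction of the restricted problem to its own core, which is
      -- therefore everything.
      (hred _ (Q.restrict K').isForgettable_core.isReducibleTo)
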